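/- Let $(X_{i,j})_{i<j}$ be i.i.d. complex random variables with $\mathbb E X_{1,2}=0$, $\mathbb E|X_{1,2}|^2=1$, let $(X_{i,i})_{i\ge 1}$ be i.i.d. real random variables, all the $(X_{i,j})_{i\le j}$ being independent, and put $X_{j,i}=\overline{X_{i,j}}$. Assume that $\Re X_{1,2}$ and $\Im X_{1,2}$ are independent, and that there are $\alpha\in(0,2)$ and $a,b\in(0,\infty)$ with $$\lim_{t\to+\infty}-t^{-\alpha}\log\mathbb P(|X_{1,1}|>t)=b,\qquad \lim_{t\to+\infty}-t^{-\alpha}\log\mathbb P(|X_{1,2}|>t)=a.$$ Assume moreover that there are probability measures $\nu_1,\nu_2$ on the unit circle $\mathbb S^1$ and $t_0>0$ such that for all $t\ge t_0$ and all measurable $U\subset\mathbb S^1$, $$\mathbb P\big(X_{1,1}/|X_{1,1}|\in U,\ |X_{1,1}|\ge t\big)=\nu_1(U)\,\mathbb P(|X_{1,1}|\ge t),\qquad \mathbb P\big(X_{1,2}/|X_{1,2}|\in U,\ |X_{1,2}|\ge t\big)=\nu_2(U)\,\mathbb P(|X_{1,2}|\ge t).$$ Let $|z|_\infty=\max(|\Re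 z|,|\Im z|)$, and for $\varepsilon>0$ and $N\ge1$ let $C^\varepsilon$ be the $N\times N$ Hermitian matrix with entries $$C^{\varepsilon}_{i,j}=\frac{X_{i,j}}{\sqrt N}\,\mathbf 1_{\varepsilon\sqrt N\le|X_{i,j}|_\infty\le\varepsilon^{-1}\sqrt N}.$$ For a Hermitian matrix $A$ of size $n\ge1$ let $\lambda_A$ be its largest eigenvalue. Let $G_{\sigma_{sc}}(x)=\int\frac{d\sigma_{sc}(t)}{x-t}$, $x\ge2$, where $\sigma_{sc}(dt)=\mathbf 1_{[-2,2]}(t)\frac1{2\pi}\sqrt{4-t^2}\,dt$, let $G_{\sigma_{sc}}^{-1}:(0,1]\to[2,\infty)$ be its inverse, and set $$\mu_{\varepsilon,N}=\begin{cases}G_{\sigma_{sc}}^{-1}(1/\lambda_{C^\varepsilon})&\text{if }\lambda_{C^\varepsilon}\ge1,\\ 2&\text{otherwise.}\end{cases}$$ Let $\mathcal D_\varepsilon$ be the set of Hermitian matrices $A\in\bigcup_{n\ge1}H_n(\mathbb C)$ such that for all $i\le j$, either $A_{i,j}=0$, or $\varepsilon\le|A_{i,j}|\le\varepsilon^{-1}$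 and $A_{i,j}/|A_{i,j}|\in\operatorname{supp}(\nu_{i,j})$, where $\nu_{i,i}=\nu_1$ and $\nu_{i,j}=\nu_2$ for $i<j$. Put $$I_\varepsilon(A)=\begin{cases} b\sum_i|A_{i,i}|^\alpha+a\sum_{i<j}|A_{i,j}|^\alpha&\text{if }A\in\mathcal D_\varepsilon,\\+\infty&\text{otherwise.}\end{cases}$$ Then for every $\varepsilon>0$ with $\varepsilon\ne1$, the sequence $(\mu_{\varepsilon,N})_{N}$ satisfies a large deviations principle on $\mathbb R$ with speed $N^{\alpha/2}$ and good rate function $$J_\varepsilon(x)=\begin{cases}\inf\big\{I_\varepsilon(A):A\in\bigcup_{n\ge1}H_n(\mathbb C),\ \lambda_A=1/G_{\sigma_{sc}}(x)\big\}&\text{if }x>2,\\0&\text{if }x=2,\\+\infty&\text{if }x<2.\end{cases}$$ That is, $J_\varepsilon:\mathbb R\to[0,+\infty]$ is lower semicontinuous, its level sets $\{J_\varepsilon\le t\}$, $t\in[0,\infty)$, are compact, and for every Borel set $B\subset\mathbb R$, $$-\inf_{B^\circ}J_\varepsilon\le\liminf_{N\to\infty}\frac{\log\mathbb P(\mu_{\varepsilon,N}\in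 B)}{N^{\alpha/2}}\le\limsup_{N\to\infty}\frac{\log\mathbb P(\mu_{\varepsilon,N}\in B)}{N^{\alpha/2}}\le-\inf_{\overline B}J_\varepsilon.$$ -/

import Mathlib

open MeasureTheory ProbabilityTheory Filter Topology
open scoped ENNReal NNReal ComplexConjugate

noncomputable section

namespace WignerLDP

/-- The semicircular law `1_{[-2,2]}(t) √(4 - t²) / (2π) dt`. -/
def semicircle : Measure ℝ :=
  volume.withDensity fun t =>
    ENNReal.ofReal ((Set.Icc (-2 : ℝ) 2).indicator (fun s => √(4 - s ^ 2) / (2 * Real.pi)) t)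

/-- The Stieltjes transform `G(x) = ∫ dσ(t) / (x - t)` of the semicircular law, at real points. -/
def stieltjes (x : ℝ) : ℝ := ∫ t, 1 / (x - t) ∂semicircle

/-- The inverse of the restriction of `G` to `[2, ∞)`; it is only used on `G '' [2, ∞) = (0, 1]`. -/
def stieltjesInv (y : ℝ) : ℝ := Function.invFunOn stieltjes (Set.Ici 2) y

/-- The largest eigenvalue of a Hermitian matrix of size `n ≥ 1`. -/
def topEigenvalue {n : ℕ} (A : Matrix (Fin n) (Fin n) ℂ) : ℝ := sSup (spectrum ℝ A)

/-- `|z|_∞ = max (|Re z|, |Im z|)`. -/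
def maxAbs (z : ℂ) : ℝ := max |z.re| |z.im|

/-- The unit circle. -/
abbrev UnitCircle : Type := Metric.sphere (0 : ℂ) 1

/-- A sequence of Wigner matrices is given by an infinite Hermitian array of random variables;
the matrix of size `N` is its upper left `N × N` corner. The rows and columns are indexed
from `0`, so that `X 0 0` and `X 0 1` are the entries written `X_{1,1}` and `X_{1,2}`. -/
structure IsWigner {Ω : Type*} [MeasurableSpace Ω] (P : Measure Ω) (X : ℕ → ℕ → Ω → ℂ) : Prop where
  measurable : ∀ i j, Measurable (X i j)
  hermitian : ∀ i j ω, X j i ω = conj (X i j ω)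
  indep : iIndepFun (fun p : {p : ℕ × ℕ // p.1 ≤ p.2} => X p.1.1 p.1.2) P
  identDistrib_diag : ∀ i, IdentDistrib (X i i) (X 0 0) P P
  identDistrib_offDiag : ∀ i j, i < j → IdentDistrib (X i j) (X 0 1) P P
  mean_zero : ∫ ω, X 0 1 ω ∂P = 0
  variance_one : ∫ ω, ‖X 0 1 ω‖ ^ 2 ∂P = 1

/-- `lim_{t → ∞} - t^{-α} log P(|Z| > t) = c`. -/
def HasTail {Ω : Type*} [MeasurableSpace Ω] (P : Measure Ω) (Z : Ω → ℂ) (α c : ℝ) : Prop :=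
  Tendsto (fun t : ℝ => -t ^ (-α) * Real.log (P.real {ω | t < ‖Z ω‖})) atTop (𝓝 c)

/-- For large values of `|Z|`, the modulus and the angle of `Z` are independent and the angle has
law `ν`. -/
def AngleDecoupled {Ω : Type*} [MeasurableSpace Ω] (P : Measure Ω) (Z : Ω → ℂ)
    (ν : Measure UnitCircle) : Prop :=
  ∃ t₀ : ℝ, 0 < t₀ ∧ ∀ t : ℝ, t₀ ≤ t → ∀ U : Set UnitCircle, MeasurableSet U →
    P {ω | Z ω / (‖Z ω‖ : ℂ) ∈ Subtype.val '' U ∧ t ≤ ‖Z ω‖} = ν U * P {ω | t ≤ ‖Z ω‖}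

/-- The assumptions on the distribution of the entries. When `X 0 1` is real-valued, the
independence of its real and imaginary parts holds trivially. -/
structure EntryAssumptions {Ω : Type*} [MeasurableSpace Ω] (P : Measure Ω) (X : ℕ → ℕ → Ω → ℂ)
    (α a b : ℝ) (ν₁ ν₂ : Measure UnitCircle) : Prop where
  alpha_pos : 0 < α
  alpha_lt_two : α < 2
  a_pos : 0 < a
  b_pos : 0 < b
  indep_re_im : IndepFun (fun ω => (X 0 1 ω).re) (fun ω => (X 0 1 ω).im) P
  tail_diag : HasTail P (X 0 0) α b
  tail_offDiag : HasTail P (X 0 1) α a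
  angle_diag : AngleDecoupled P (X 0 0) ν₁
  angle_offDiag : AngleDecoupled P (X 0 1) ν₂

open Classical in
/-- The matrix `C^ε` of size `N`: the entries of `X / √N` with
`ε √N ≤ |X_{i,j}|_∞ ≤ ε⁻¹ √N`, the others being replaced by zero. -/
def truncated {Ω : Type*} (X : ℕ → ℕ → Ω → ℂ) (ε : ℝ) (N : ℕ) (ω : Ω) :
    Matrix (Fin N) (Fin N) ℂ :=
  Matrix.of fun i j =>
    if ε * √(N : ℝ) ≤ maxAbs (X i j ω) ∧ maxAbs (X i j ω) ≤ ε⁻¹ * √(N : ℝ)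
    then X i j ω / (√(N : ℝ) : ℂ) else 0

open Classical in
/-- `μ_{ε,N}`. -/
def mu {Ω : Type*} (X : ℕ → ℕ → Ω → ℂ) (ε : ℝ) (N : ℕ) (ω : Ω) : ℝ :=
  if 1 ≤ topEigenvalue (truncated X ε N ω)
  then stieltjesInv (1 / topEigenvalue (truncated X ε N ω)) else 2

/-- The set `𝒟_ε`, for matrices of size `n`. -/
def admissible (ε : ℝ) (ν₁ ν₂ : Measure UnitCircle) (n : ℕ) : Set (Matrix (Fin n) (Fin n) ℂ) :=
  {A | A.IsHermitian ∧ ∀ i j, i ≤ j → A i j = 0 ∨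
    (ε ≤ ‖A i j‖ ∧ ‖A i j‖ ≤ ε⁻¹ ∧
      A i j / (‖A i j‖ : ℂ) ∈ Subtype.val '' (if i = j then ν₁ else ν₂).support)}

open Classical in
/-- The function `I_ε`. -/
def matrixCost (ε α a b : ℝ) (ν₁ ν₂ : Measure UnitCircle) {n : ℕ}
    (A : Matrix (Fin n) (Fin n) ℂ) : ℝ≥0∞ :=
  if A ∈ admissible ε ν₁ ν₂ n then
    ENNReal.ofReal (b * ∑ i, ‖A i i‖ ^ α +
      a * ∑ p : Fin n × Fin n with p.1 < p.2, ‖A p.1 p.2‖ ^ α)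
  else ⊤

open Classical in
/-- The function `J_ε`. -/
def rate (ε α a b : ℝ) (ν₁ ν₂ : Measure UnitCircle) (x : ℝ) : ℝ≥0∞ :=
  if 2 < x then
    ⨅ (n : ℕ) (_ : 1 ≤ n) (A : Matrix (Fin n) (Fin n) ℂ) (_ : A.IsHermitian)
      (_ : topEigenvalue A = 1 / stieltjes x), matrixCost ε α a b ν₁ ν₂ A
  else if x = 2 then 0
  else ⊤

/-- The random variables `Z n` satisfy a large deviations principle with speed `v` and good rate
function `J`. Here `ENNReal.log 0 = -∞`, and the infimum of `J` over the empty set is `+∞`. -/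
structure SatisfiesLDP {Ω 𝒳 : Type*} [MeasurableSpace Ω] [TopologicalSpace 𝒳] [MeasurableSpace 𝒳]
    [BorelSpace 𝒳] (P : Measure Ω) (Z : ℕ → Ω → 𝒳) (v : ℕ → ℝ) (J : 𝒳 → ℝ≥0∞) : Prop where
  measurable : ∀ n, Measurable (Z n)
  speed_mono : Monotone v
  speed_tendsto : Tendsto v atTop atTop
  lowerSemicontinuous : LowerSemicontinuous J
  good : ∀ t : ℝ≥0, IsCompact {x | J x ≤ t}
  lower_bound : ∀ B : Set 𝒳, MeasurableSet B →
    -((⨅ x ∈ interior B, J x : ℝ≥0∞) : EReal) ≤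
      liminf (fun n => ENNReal.log (P {ω | Z n ω ∈ B}) / ((v n : ℝ) : EReal)) atTop
  upper_bound : ∀ B : Set 𝒳, MeasurableSet B →
    limsup (fun n => ENNReal.log (P {ω | Z n ω ∈ B}) / ((v n : ℝ) : EReal)) atTop ≤
      -((⨅ x ∈ closure B, J x : ℝ≥0∞) : EReal)

end WignerLDP

end

namespace WignerLDP

/-! At speed `N ^ (α / 2)` an entry survives the truncation only with probability `exp (-κ N ^ (α /
2))`, while placing an entry of modulus `r` at a given diagonal (resp. off-diagonal) position costs
`b * r ^ α` (resp. `a * r ^ α`). So `C^ε` is at finite cost a sparse matrix, and `μ_{ε,N}` is a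
continuous function, `outlier`, of its top eigenvalue. The rate is the least cost over each fibre of
this function, the zero matrix giving cost zero at `2`.

Upper bound. For large `N`, almost surely `C^ε` is itself admissible, hence a competitor in the
infimum defining the rate at `μ_{ε,N}` (`rate_outlier_le`). So `μ_{ε,N} ∈ B` forces the cost of
`C^ε` to be at least the infimum of the rate over `B`. Exponential Chebyshev with a parameter `θ <
1`, factored over at most `N ^ 2` independent entries each contributing `1 + O(exp (-κ N ^ (α /
2)))`, bounds this event (`eventually_measure_le_entryCost_le`). No exponential tightness or
covering is needed.

Lower bound. Given an admissible `A` of fixed size, put entries close to those of `A` in the corner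
and zeros elsewhere. Independence gives the probability, and continuity of the top eigenvalue does
the rest (`eventually_le_measure_mu_mem`).

Goodness. Zero rows and columns can be deleted, and each nonzero entry costs at least `min a b * ε ^
α`, so only finitely many sizes matter below a given cost (`exists_compression`). Level sets are
then finite unions of continuous images of compact sets.

The truncation uses `maxAbs` but admissibility uses the modulus. They agree on large entries:
independence of real and imaginary parts, with `α < 2`, confines the limiting directions to the
coordinate axes (`re_eq_zero_or_im_eq_zero`). -/

/-! ### The Stieltjes transform of the semicircular law on `[2, ∞)` -/

/-- The integrand of the Stieltjes transform of the semicircular law. -/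
noncomputable def stieltjesKernel (x t : ℝ) : ℝ := √(4 - t ^ 2) / (2 * Real.pi) * (1 / (x - t))

lemma stieltjes_eq_intervalIntegral (x : ℝ) :
    stieltjes x = ∫ t in (-2 : ℝ)..2, stieltjesKernel x t := by
  unfold stieltjes semicircle
  rw [integral_withDensity_eq_integral_toReal_smul]
  · rw [intervalIntegral.integral_of_le (by norm_num), ← integral_Icc_eq_integral_Ioc,
      ← integral_indicator measurableSet_Icc]
    refine integral_congr_ae (Eventually.of_forall fun t => ?_)
    by_cases ht : t ∈ Set.Icc (-2 : ℝ) 2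
    · simp only [Set.indicator_of_mem ht, smul_eq_mul, stieltjesKernel]
      rw [ENNReal.toReal_ofReal (by positivity)]
    · simp [Set.indicator_of_notMem ht]
  · refine ENNReal.measurable_ofReal.comp (Measurable.indicator ?_ measurableSet_Icc)
    fun_prop
  · exact Eventually.of_forall fun t => ENNReal.ofReal_lt_top

lemma stieltjesKernel_pos {x t : ℝ} (hx : 2 ≤ x) (ht : t ∈ Set.Ioo (-2 : ℝ) 2) :
    0 < stieltjesKernel x t := by
  obtain ⟨h1, h2⟩ := ht
  have h3 : 0 < 4 - t ^ 2 := by nlinarith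
  have h4 : 0 < x - t := by linarith
  have := Real.sqrt_pos.2 h3
  unfold stieltjesKernel
  positivity

lemma stieltjesKernel_lt {x y t : ℝ} (hx : 2 ≤ x) (hxy : x < y) (ht : t ∈ Set.Ioo (-2 : ℝ) 2) :
    stieltjesKernel y t < stieltjesKernel x t := by
  obtain ⟨h1, h2⟩ := ht
  have h3 : 0 < 4 - t ^ 2 := by nlinarith
  have := Real.sqrt_pos.2 h3
  unfold stieltjesKernel
  refine mul_lt_mul_of_pos_left ?_ (by positivity)
  exact one_div_lt_one_div_of_lt (by linarith) (by linarith)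

/-- At `x = 2` the kernel is `√((2 + t) / (2 - t)) / (2π)`, singular at `t = 2`, but its primitive
is explicit and continuous up to the endpoints. This yields both integrability and the value `1`. -/
lemma hasDerivAt_stieltjesKernel_two {t : ℝ} (ht : t ∈ Set.Ioo (-2 : ℝ) 2) :
    HasDerivAt (fun t => (2 * Real.arcsin (t / 2) - √(4 - t ^ 2)) / (2 * Real.pi))
      (stieltjesKernel 2 t) t := by
  obtain ⟨h1, h2⟩ := ht
  have h3 : 0 < 4 - t ^ 2 := by nlinarith
  have h4 := Real.sqrt_pos.2 h3
  have d1 : HasDerivAt (fun t : ℝ => Real.arcsin (t / 2)) (1 / √(1 - (t / 2) ^ 2) * (1 / 2)) t :=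
    (Real.hasDerivAt_arcsin (by linarith) (by linarith)).comp t ((hasDerivAt_id t).div_const 2)
  have d2 : HasDerivAt (fun t : ℝ => √(4 - t ^ 2)) ((-(2 * t)) / (2 * √(4 - t ^ 2))) t := by
    refine HasDerivAt.sqrt ?_ h3.ne'
    simpa using (hasDerivAt_pow 2 t).const_sub 4
  refine (((d1.const_mul 2).sub d2).div_const (2 * Real.pi)).congr_deriv ?_
  have h5 : √(1 - (t / 2) ^ 2) = √(4 - t ^ 2) / 2 := by
    rw [show 1 - (t / 2) ^ 2 = (4 - t ^ 2) / 2 ^ 2 by ring, Real.sqrt_div h3.le,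
      Real.sqrt_sq (by norm_num)]
  have h6 : √(4 - t ^ 2) ^ 2 = 4 - t ^ 2 := Real.sq_sqrt h3.le
  have h7 : 2 - t ≠ 0 := by linarith
  rw [h5, stieltjesKernel]
  field_simp
  rw [h6]
  ring

lemma continuousOn_primitive_stieltjesKernel_two :
    ContinuousOn (fun t => (2 * Real.arcsin (t / 2) - √(4 - t ^ 2)) / (2 * Real.pi))
      (Set.Icc (-2 : ℝ) 2) := by
  have := Real.continuous_arcsin
  fun_prop

lemma intervalIntegrable_stieltjesKernel_two :
    IntervalIntegrable (stieltjesKernel 2) volume (-2) 2 := by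
  rw [intervalIntegrable_iff_integrableOn_Ioc_of_le (by norm_num)]
  exact intervalIntegral.integrableOn_deriv_of_nonneg continuousOn_primitive_stieltjesKernel_two
    (fun t ht => hasDerivAt_stieltjesKernel_two ht) fun t ht => (stieltjesKernel_pos le_rfl ht).le

lemma stieltjes_two : stieltjes 2 = 1 := by
  rw [stieltjes_eq_intervalIntegral, intervalIntegral.integral_eq_sub_of_hasDerivAt_of_le
    (by norm_num) continuousOn_primitive_stieltjesKernel_two
    (fun t ht => hasDerivAt_stieltjesKernel_two ht) intervalIntegrable_stieltjesKernel_two]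
  have := Real.pi_pos
  norm_num
  field_simp
  ring

lemma measurable_stieltjesKernel (x : ℝ) : Measurable (stieltjesKernel x) := by
  unfold stieltjesKernel
  fun_prop

lemma ae_mem_Ioo_of_mem_uIoc : ∀ᵐ t : ℝ, t ∈ Set.uIoc (-2 : ℝ) 2 → t ∈ Set.Ioo (-2 : ℝ) 2 := by
  have h : ∀ᵐ t : ℝ, t ≠ 2 := by simp [ae_iff]
  filter_upwards [h] with t ht h2
  rw [Set.uIoc_of_le (by norm_num)] at h2
  exact ⟨h2.1, lt_of_le_of_ne h2.2 ht⟩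

/-- The kernel at `2` dominates all the others, which is what integrability and dominated
convergence up to the endpoint require. -/
lemma norm_stieltjesKernel_le {x t : ℝ} (hx : 2 ≤ x) (ht : t ∈ Set.Ioo (-2 : ℝ) 2) :
    ‖stieltjesKernel x t‖ ≤ stieltjesKernel 2 t := by
  rw [Real.norm_of_nonneg (stieltjesKernel_pos hx ht).le]
  rcases hx.eq_or_lt with rfl | h
  · exact le_rfl
  · exact (stieltjesKernel_lt le_rfl h ht).le

lemma intervalIntegrable_stieltjesKernel {x : ℝ} (hx : 2 ≤ x) :
    IntervalIntegrable (stieltjesKernel x) volume (-2) 2 := by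
  refine intervalIntegrable_stieltjesKernel_two.mono_fun
    (measurable_stieltjesKernel x).aestronglyMeasurable ?_
  rw [Filter.EventuallyLE, ae_restrict_iff' measurableSet_uIoc]
  filter_upwards [ae_mem_Ioo_of_mem_uIoc] with t ht h
  exact (norm_stieltjesKernel_le hx (ht h)).trans (le_abs_self _)

lemma strictAntiOn_stieltjes : StrictAntiOn stieltjes (Set.Ici 2) := by
  intro x hx y hy hxy
  rw [stieltjes_eq_intervalIntegral, stieltjes_eq_intervalIntegral, ← sub_pos,
    ← intervalIntegral.integral_sub (intervalIntegrable_stieltjesKernel hx)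
      (intervalIntegrable_stieltjesKernel hy)]
  refine intervalIntegral.intervalIntegral_pos_of_pos_on
    ((intervalIntegrable_stieltjesKernel hx).sub (intervalIntegrable_stieltjesKernel hy)) ?_
    (by norm_num)
  intro t ht
  exact sub_pos.2 (stieltjesKernel_lt hx hxy ht)

lemma continuousOn_stieltjes : ContinuousOn stieltjes (Set.Ici 2) := by
  intro x hx
  have h : stieltjes = fun x => ∫ t in (-2 : ℝ)..2, stieltjesKernel x t :=
    funext stieltjes_eq_intervalIntegral
  rw [h]
  refine intervalIntegral.continuousWithinAt_of_dominated_interval (bound := stieltjesKernel 2)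
    (Eventually.of_forall fun y => (measurable_stieltjesKernel y).aestronglyMeasurable) ?_
    intervalIntegrable_stieltjesKernel_two ?_
  · filter_upwards [self_mem_nhdsWithin] with y hy
    filter_upwards [ae_mem_Ioo_of_mem_uIoc] with t ht h
    exact norm_stieltjesKernel_le hy (ht h)
  · filter_upwards [ae_mem_Ioo_of_mem_uIoc] with t ht h
    have hx' : (2 : ℝ) ≤ x := hx
    have : x - t ≠ 0 := by linarith [(ht h).2]
    unfold stieltjesKernel
    fun_prop (disch := exact this)

/-- Decay at infinity, needed for surjectivity onto `(0, 1]`. The factor `4` bounds `2 - t`, so that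
the comparison is with the kernel at `2`, whose integral is already known. -/
lemma stieltjes_le {x : ℝ} (hx : 2 < x) : stieltjes x ≤ 4 / (x - 2) := by
  calc stieltjes x = ∫ t in (-2 : ℝ)..2, stieltjesKernel x t := stieltjes_eq_intervalIntegral x
    _ ≤ ∫ t in (-2 : ℝ)..2, 4 / (x - 2) * stieltjesKernel 2 t := by
      refine intervalIntegral.integral_mono_on_of_le_Ioo (by norm_num)
        (intervalIntegrable_stieltjesKernel hx.le)
        (intervalIntegrable_stieltjesKernel_two.const_mul _) fun t ht => ?_
      obtain ⟨h1, h2⟩ := ht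
      have h3 : 0 < x - t := by linarith
      have h4 : 0 < 2 - t := by linarith
      have h5 : 0 < x - 2 := by linarith
      have h6 : 1 / (x - t) ≤ 4 / (x - 2) * (1 / (2 - t)) := by
        rw [div_mul_div_comm, div_le_div_iff₀ h3 (by positivity)]
        nlinarith
      unfold stieltjesKernel
      rw [mul_left_comm]
      exact mul_le_mul_of_nonneg_left h6 (by positivity)
    _ = 4 / (x - 2) := by
      rw [intervalIntegral.integral_const_mul, ← stieltjes_eq_intervalIntegral, stieltjes_two,
        mul_one]

lemma stieltjes_pos {x : ℝ} (hx : 2 ≤ x) : 0 < stieltjes x := by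
  rw [stieltjes_eq_intervalIntegral]
  exact intervalIntegral.intervalIntegral_pos_of_pos_on (intervalIntegrable_stieltjesKernel hx)
    (fun t ht => stieltjesKernel_pos hx ht) (by norm_num)

lemma surjOn_stieltjes : Set.SurjOn stieltjes (Set.Ici 2) (Set.Ioc 0 1) := by
  rintro y ⟨hy0, hy1⟩
  have hM : (2 : ℝ) < 2 + 4 / y := by have : 0 < 4 / y := by positivity
                                      linarith
  have hMle : stieltjes (2 + 4 / y) ≤ y := by
    refine (stieltjes_le hM).trans (le_of_eq ?_)
    field_simp
    ring
  obtain ⟨x, hx, rfl⟩ := intermediate_value_Icc' hM.le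
    (continuousOn_stieltjes.mono Set.Icc_subset_Ici_self) ⟨hMle, hy1.trans_eq stieltjes_two.symm⟩
  exact ⟨x, hx.1, rfl⟩

lemma two_le_stieltjesInv {y : ℝ} (hy : y ∈ Set.Ioc (0 : ℝ) 1) : 2 ≤ stieltjesInv y :=
  Function.invFunOn_mem (surjOn_stieltjes hy)

lemma stieltjes_stieltjesInv {y : ℝ} (hy : y ∈ Set.Ioc (0 : ℝ) 1) :
    stieltjes (stieltjesInv y) = y :=
  Function.invFunOn_eq (surjOn_stieltjes hy)

lemma stieltjes_mem_Ioc {x : ℝ} (hx : 2 ≤ x) : stieltjes x ∈ Set.Ioc (0 : ℝ) 1 :=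
  ⟨stieltjes_pos hx, stieltjes_two ▸ strictAntiOn_stieltjes.antitoneOn Set.self_mem_Ici hx hx⟩

lemma stieltjesInv_stieltjes {x : ℝ} (hx : 2 ≤ x) : stieltjesInv (stieltjes x) = x :=
  strictAntiOn_stieltjes.injOn (two_le_stieltjesInv (stieltjes_mem_Ioc hx)) hx
    (stieltjes_stieltjesInv (stieltjes_mem_Ioc hx))

/-! ### The outlier map -/

open Classical in
/-- The position of the top eigenvalue of a Wigner matrix perturbed by a matrix whose top
eigenvalue is `y`. -/
noncomputable def outlier (y : ℝ) : ℝ := if 1 ≤ y then stieltjesInv (1 / y) else 2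

lemma one_div_mem_Ioc {y : ℝ} (hy : 1 ≤ y) : 1 / y ∈ Set.Ioc (0 : ℝ) 1 :=
  ⟨by positivity, by rw [div_le_one (by linarith)]; exact hy⟩

lemma two_le_outlier (y : ℝ) : 2 ≤ outlier y := by
  unfold outlier
  split_ifs with h
  · exact two_le_stieltjesInv (one_div_mem_Ioc h)
  · exact le_rfl

lemma outlier_eq_two {y : ℝ} (hy : y ≤ 1) : outlier y = 2 := by
  unfold outlier
  split_ifs with h
  · obtain rfl : y = 1 := le_antisymm hy h
    rw [div_one, ← stieltjes_two, stieltjesInv_stieltjes le_rfl]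
  · rfl

/-- Allows working with `max 0 (topEigenvalue A)`, which, unlike `topEigenvalue A`, is insensitive
to zero padding and to the empty matrix. -/
lemma outlier_max_zero (y : ℝ) : outlier (max 0 y) = outlier y := by
  rcases le_total 0 y with h | h
  · rw [max_eq_right h]
  · rw [max_eq_left h, outlier_eq_two zero_le_one, outlier_eq_two (h.trans zero_le_one)]

lemma outlier_one_div_stieltjes {x : ℝ} (hx : 2 ≤ x) : outlier (1 / stieltjes x) = x := by
  obtain ⟨h0, h1⟩ := stieltjes_mem_Ioc hx
  unfold outlier
  rw [if_pos (by rwa [le_div_iff₀ h0, one_mul]), one_div_one_div, stieltjesInv_stieltjes hx]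

lemma stieltjes_outlier {y : ℝ} (hy : 1 ≤ y) : stieltjes (outlier y) = 1 / y := by
  unfold outlier
  rw [if_pos hy, stieltjes_stieltjesInv (one_div_mem_Ioc hy)]

lemma outlier_eq_iff {x y : ℝ} (hx : 2 < x) : outlier y = x ↔ y = 1 / stieltjes x := by
  constructor
  · rintro rfl
    have hy : 1 ≤ y := by
      by_contra! h
      exact hx.ne' (outlier_eq_two h.le)
    rw [stieltjes_outlier hy, one_div_one_div]
  · rintro rfl
    exact outlier_one_div_stieltjes hx.le

lemma monotone_outlier : Monotone outlier := by
  intro y z hyz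
  rcases le_total y 1 with h | h
  · rw [outlier_eq_two h]
    exact two_le_outlier z
  · by_contra! hlt
    have := strictAntiOn_stieltjes (two_le_outlier z) (two_le_outlier y) hlt
    rw [stieltjes_outlier h, stieltjes_outlier (h.trans hyz)] at this
    exact absurd (one_div_le_one_div_of_le (by linarith) hyz) (not_le.2 this)

/-- A monotone surjection onto `[2, ∞)` has no jumps. -/
lemma continuous_outlier : Continuous outlier := by
  have hmono : Monotone fun y => (⟨outlier y, two_le_outlier y⟩ : Set.Ici (2 : ℝ)) :=
    fun y z h => monotone_outlier h
  have hsurj : Function.Surjective fun y => (⟨outlier y, two_le_outlier y⟩ : Set.Ici (2 : ℝ)) :=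
    fun x => ⟨1 / stieltjes x, Subtype.ext (outlier_one_div_stieltjes x.2)⟩
  exact continuous_subtype_val.comp (hmono.continuous_of_surjective hsurj)

lemma mu_eq_outlier {Ω : Type*} (X : ℕ → ℕ → Ω → ℂ) (ε : ℝ) (N : ℕ) (ω : Ω) :
    mu X ε N ω = outlier (topEigenvalue (truncated X ε N ω)) := rfl

/-! ### Top eigenvalues: Rayleigh bounds, deletion of zero rows, continuity -/

open Matrix in
open scoped ComplexOrder Pointwise in
/-- The Rayleigh characterization of upper bounds of the spectrum. Nonnegativity of `t` is only
needed for the matrix of size zero. -/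
lemma topEigenvalue_le_iff {n : ℕ} {A : Matrix (Fin n) (Fin n) ℂ} (hA : A.IsHermitian) {t : ℝ}
    (ht : 0 ≤ t) :
    topEigenvalue A ≤ t ↔
      ∀ v : Fin n → ℂ, (star v ⬝ᵥ (A *ᵥ v)).re ≤ t * ∑ i, ‖v i‖ ^ 2 := by
  have hB : ((algebraMap ℝ (Matrix (Fin n) (Fin n) ℂ) t) - A).IsHermitian := by
    refine Matrix.IsHermitian.sub ?_ hA
    rw [Matrix.IsHermitian, Matrix.algebraMap_eq_diagonal, Matrix.diagonal_conjTranspose]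
    congr 1
    ext i
    simp
  have h1 : topEigenvalue A ≤ t ↔ ∀ s ∈ spectrum ℝ A, s ≤ t := by
    unfold topEigenvalue
    constructor
    · intro h s hs
      refine (le_csSup ?_ hs).trans h
      rw [hA.spectrum_real_eq_range_eigenvalues]
      exact (Set.finite_range _).bddAbove
    · intro h
      exact Real.sSup_le h ht
  have h2 : (∀ s ∈ spectrum ℝ A, s ≤ t) ↔
      ((algebraMap ℝ (Matrix (Fin n) (Fin n) ℂ) t) - A).PosSemidef := by
    rw [hB.posSemidef_iff_eigenvalues_nonneg, Pi.le_def]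
    have h3 : Set.range hB.eigenvalues = ({t} : Set ℝ) - spectrum ℝ A := by
      rw [← hB.spectrum_real_eq_range_eigenvalues, spectrum.singleton_sub_eq]
    constructor
    · intro h i
      have : hB.eigenvalues i ∈ ({t} - spectrum ℝ A : Set ℝ) := h3 ▸ Set.mem_range_self i
      obtain ⟨_, rfl, s, hs, hsi⟩ := this
      rw [← hsi]
      exact sub_nonneg.2 (h s hs)
    · intro h s hs
      have : t - s ∈ Set.range hB.eigenvalues := h3 ▸ ⟨t, rfl, s, hs, rfl⟩
      obtain ⟨i, hi⟩ := this
      exact sub_nonneg.1 (hi ▸ h i)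
  have h4 : ∀ v : Fin n → ℂ,
      star v ⬝ᵥ (((algebraMap ℝ (Matrix (Fin n) (Fin n) ℂ) t) - A) *ᵥ v) =
        ((t * ∑ i, ‖v i‖ ^ 2 : ℝ) : ℂ) - star v ⬝ᵥ (A *ᵥ v) := by
    intro v
    rw [Matrix.sub_mulVec, dotProduct_sub]
    congr 1
    rw [Matrix.algebraMap_eq_diagonal, dotProduct]
    push_cast
    rw [Finset.mul_sum]
    refine Finset.sum_congr rfl fun i _ => ?_
    rw [Matrix.mulVec_diagonal]
    simp only [Pi.star_apply, RCLike.star_def, Pi.algebraMap_apply, Complex.coe_algebraMap]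
    rw [mul_left_comm, Complex.conj_mul']
  rw [h1, h2, Matrix.posSemidef_iff_dotProduct_mulVec]
  constructor
  · rintro ⟨-, h⟩ v
    have := (Complex.le_def.1 (h v)).1
    rw [h4, Complex.sub_re, Complex.ofReal_re] at this
    exact sub_nonneg.1 this
  · intro h
    refine ⟨hB, fun v => Complex.le_def.2 ⟨?_, ?_⟩⟩
    · rw [h4, Complex.sub_re, Complex.ofReal_re]
      exact sub_nonneg.2 (h v)
    · have := hB.im_star_dotProduct_mulVec_self v
      simpa using this.symm

lemma sum_comp_of_injective {ι κ M : Type*} [Fintype ι] [Fintype κ] [AddCommMonoid M] {f : ι → κ}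
    (hf : Function.Injective f) (g : κ → M) (h : ∀ k, g k ≠ 0 → k ∈ Set.range f) :
    ∑ i, g (f i) = ∑ k, g k :=
  Finset.sum_of_injOn f hf.injOn (fun _ _ => Finset.mem_coe.2 (Finset.mem_univ _))
    (fun k _ hk => by
      by_contra hk'
      exact hk (by simpa using h k hk')) fun _ _ => rfl

lemma sum_comp_le_of_injective {ι κ : Type*} [Fintype ι] [Fintype κ] {f : ι → κ}
    (hf : Function.Injective f) {g : κ → ℝ} (hg : ∀ k, 0 ≤ g k) : ∑ i, g (f i) ≤ ∑ k, g k :=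
  calc ∑ i, g (f i) = ∑ k ∈ Finset.univ.map ⟨f, hf⟩, g k := by
        rw [Finset.sum_map]
        rfl
    _ ≤ ∑ k, g k :=
        Finset.sum_le_sum_of_subset_of_nonneg (Finset.subset_univ _) fun _ _ _ => hg _

lemma max_zero_topEigenvalue_le {m n : ℕ} {A : Matrix (Fin m) (Fin m) ℂ}
    {B : Matrix (Fin n) (Fin n) ℂ} (h : ∀ t, 0 ≤ t → topEigenvalue A ≤ t → topEigenvalue B ≤ t) :
    max 0 (topEigenvalue B) ≤ max 0 (topEigenvalue A) :=
  max_le (le_max_left _ _) (h _ (le_max_left _ _) (le_max_right _ _))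

-- The quadratic form of `A` only sees the coordinates in the range of `f`, so Rayleigh bounds pass
-- both ways, by restricting vectors and by extending them by zero. The maximum with `0` absorbs the
-- eigenvalue `0` created by zero rows.
open Matrix in
lemma max_zero_topEigenvalue_submatrix {m n : ℕ} {A : Matrix (Fin n) (Fin n) ℂ}
    (hA : A.IsHermitian) {f : Fin m → Fin n} (hf : Function.Injective f)
    (h0 : ∀ i j, A i j ≠ 0 → i ∈ Set.range f ∧ j ∈ Set.range f) :
    max 0 (topEigenvalue (A.submatrix f f)) = max 0 (topEigenvalue A) := by
  have key : ∀ v : Fin n → ℂ,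
      star (v ∘ f) ⬝ᵥ (A.submatrix f f *ᵥ (v ∘ f)) = star v ⬝ᵥ (A *ᵥ v) := by
    intro v
    simp only [dotProduct, mulVec, Matrix.submatrix_apply, Pi.star_apply, Function.comp_apply]
    have inner : ∀ i, ∑ j, A i (f j) * v (f j) = ∑ j, A i j * v j := fun i => by
      refine sum_comp_of_injective hf (fun j => A i j * v j) ?_
      intro j hj
      by_contra hj'
      exact hj' (h0 i j (left_ne_zero_of_mul hj)).2
    simp_rw [inner]
    refine sum_comp_of_injective hf (fun i => star (v i) * ∑ j, A i j * v j) ?_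
    intro i hi
    obtain ⟨j, -, hj⟩ := Finset.exists_ne_zero_of_sum_ne_zero (right_ne_zero_of_mul hi)
    exact (h0 i j (left_ne_zero_of_mul hj)).1
  have hA' : (A.submatrix f f).IsHermitian := hA.submatrix f
  refine le_antisymm (max_zero_topEigenvalue_le fun t ht h => ?_)
    (max_zero_topEigenvalue_le fun t ht h => ?_)
  · rw [topEigenvalue_le_iff hA ht] at h
    rw [topEigenvalue_le_iff hA' ht]
    intro w
    have hw : Function.extend f w 0 ∘ f = w := Function.extend_comp hf w 0
    have h1 := h (Function.extend f w 0)
    rw [← key, hw] at h1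
    refine h1.trans_eq ?_
    congr 1
    rw [← sum_comp_of_injective hf (fun i => ‖Function.extend f w 0 i‖ ^ 2)]
    · simp [hf.extend_apply]
    · intro i hi
      by_contra hi'
      exact hi (by simp [Function.extend_apply' _ _ _ hi'])
  · rw [topEigenvalue_le_iff hA' ht] at h
    rw [topEigenvalue_le_iff hA ht]
    intro v
    rw [← key]
    refine (h (v ∘ f)).trans (mul_le_mul_of_nonneg_left ?_ ht)
    exact sum_comp_le_of_injective hf (g := fun i => ‖v i‖ ^ 2) fun i => by positivity

lemma outlier_topEigenvalue_submatrix {m n : ℕ} {A : Matrix (Fin n) (Fin n) ℂ}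
    (hA : A.IsHermitian) {f : Fin m → Fin n} (hf : Function.Injective f)
    (h0 : ∀ i j, A i j ≠ 0 → i ∈ Set.range f ∧ j ∈ Set.range f) :
    outlier (topEigenvalue (A.submatrix f f)) = outlier (topEigenvalue A) := by
  rw [← outlier_max_zero, max_zero_topEigenvalue_submatrix hA hf h0, outlier_max_zero]

-- Cauchy–Schwarz bounds the quadratic form of a matrix with entries at most `δ` by `n * δ` times
-- the squared norm.
open Matrix in
lemma max_zero_topEigenvalue_le_add {n : ℕ} {A B : Matrix (Fin n) (Fin n) ℂ}
    (hA : A.IsHermitian) (hB : B.IsHermitian) {δ : ℝ} (hδ : 0 ≤ δ)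
    (h : ∀ i j, ‖A i j - B i j‖ ≤ δ) :
    max 0 (topEigenvalue A) ≤ max 0 (topEigenvalue B) + n * δ := by
  have h0 : 0 ≤ max 0 (topEigenvalue B) + n * δ := by positivity
  refine max_le h0 ((topEigenvalue_le_iff hA h0).2 fun v => ?_)
  have h1 := (topEigenvalue_le_iff hB (le_max_left _ _)).1 (le_max_right 0 (topEigenvalue B)) v
  have h2 : star v ⬝ᵥ (A *ᵥ v) = star v ⬝ᵥ (B *ᵥ v) + star v ⬝ᵥ ((A - B) *ᵥ v) := by
    rw [← dotProduct_add, ← Matrix.add_mulVec, add_sub_cancel]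
  have h3 : ‖star v ⬝ᵥ ((A - B) *ᵥ v)‖ ≤ n * δ * ∑ i, ‖v i‖ ^ 2 := by
    calc ‖star v ⬝ᵥ ((A - B) *ᵥ v)‖ ≤ ∑ i, ∑ j, ‖v i‖ * (δ * ‖v j‖) := by
          simp only [dotProduct, mulVec, Pi.star_apply, Finset.mul_sum]
          refine (norm_sum_le _ _).trans (Finset.sum_le_sum fun i _ => ?_)
          refine (norm_sum_le _ _).trans (Finset.sum_le_sum fun j _ => ?_)
          rw [norm_mul, norm_mul, norm_star]
          gcongr
          exact h i j
      _ = δ * (∑ i, ‖v i‖) ^ 2 := by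
          rw [sq, Finset.sum_mul_sum, Finset.mul_sum]
          refine Finset.sum_congr rfl fun i _ => ?_
          rw [Finset.mul_sum]
          exact Finset.sum_congr rfl fun j _ => by ring
      _ ≤ δ * (n * ∑ i, ‖v i‖ ^ 2) := by
          gcongr
          simpa using sq_sum_le_card_mul_sum_sq (s := Finset.univ) (f := fun i => ‖v i‖)
      _ = n * δ * ∑ i, ‖v i‖ ^ 2 := by ring
  rw [h2, Complex.add_re, add_mul]
  exact add_le_add h1 ((Complex.re_le_norm _).trans h3)

lemma continuousOn_outlier_topEigenvalue (n : ℕ) :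
    ContinuousOn (fun A : Matrix (Fin n) (Fin n) ℂ => outlier (topEigenvalue A))
      {A | A.IsHermitian} := by
  suffices h : ContinuousOn (fun A : Matrix (Fin n) (Fin n) ℂ => max 0 (topEigenvalue A))
      {A | A.IsHermitian} by
    refine (continuous_outlier.comp_continuousOn h).congr fun A _ => ?_
    exact (outlier_max_zero _).symm
  intro A hA
  rw [ContinuousWithinAt, Metric.tendsto_nhds]
  intro η hη
  have hδ : 0 < η / (n + 1) := by positivity
  have hlt : n * (η / (n + 1)) < η := by
    rw [← mul_div_assoc, div_lt_iff₀ (by positivity)]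
    nlinarith
  have hev : ∀ᶠ B in 𝓝[{A : Matrix (Fin n) (Fin n) ℂ | A.IsHermitian}] A,
      ∀ i j, ‖B i j - A i j‖ < η / (n + 1) := by
    refine nhdsWithin_le_nhds ?_
    refine eventually_all.2 fun i => eventually_all.2 fun j => ?_
    have hc : Continuous fun B : Matrix (Fin n) (Fin n) ℂ => ‖B i j - A i j‖ :=
      ((continuous_id.matrix_elem i j).sub continuous_const).norm
    exact hc.continuousAt.eventually_lt continuousAt_const (by simpa using hδ)
  filter_upwards [hev, self_mem_nhdsWithin] with B hB hBH
  have e1 := max_zero_topEigenvalue_le_add hBH hA hδ.le fun i j => (hB i j).le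
  have e2 := max_zero_topEigenvalue_le_add hA hBH hδ.le fun i j => by
    rw [norm_sub_rev]; exact (hB i j).le
  rw [Real.dist_eq, abs_sub_lt_iff]
  constructor <;> linarith

lemma outlier_topEigenvalue_zero (n : ℕ) :
    outlier (topEigenvalue (0 : Matrix (Fin n) (Fin n) ℂ)) = 2 := by
  refine outlier_eq_two ((topEigenvalue_le_iff Matrix.isHermitian_zero zero_le_one).2 fun v => ?_)
  simp only [Matrix.zero_mulVec, dotProduct_zero, Complex.zero_re]
  positivity

/-! ### Truncated entries and measurability -/

lemma maxAbs_conj (z : ℂ) : maxAbs (conj z) = maxAbs z := by simp [maxAbs]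

lemma maxAbs_le_norm (z : ℂ) : maxAbs z ≤ ‖z‖ :=
  max_le (Complex.abs_re_le_norm z) (Complex.abs_im_le_norm z)

lemma measurable_maxAbs : Measurable maxAbs := by
  unfold maxAbs
  fun_prop

open Classical in
/-- The truncation of a single entry. -/
noncomputable def truncEntry (ε : ℝ) (N : ℕ) (z : ℂ) : ℂ :=
  if ε * √(N : ℝ) ≤ maxAbs z ∧ maxAbs z ≤ ε⁻¹ * √(N : ℝ) then z / (√(N : ℝ) : ℂ) else 0

lemma truncated_apply {Ω : Type*} (X : ℕ → ℕ → Ω → ℂ) (ε : ℝ) (N : ℕ) (ω : Ω) (i j : Fin N) :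
    truncated X ε N ω i j = truncEntry ε N (X i j ω) := rfl

lemma truncEntry_conj (ε : ℝ) (N : ℕ) (z : ℂ) :
    truncEntry ε N (conj z) = conj (truncEntry ε N z) := by
  unfold truncEntry
  rw [maxAbs_conj]
  split_ifs <;> simp

lemma measurable_truncEntry (ε : ℝ) (N : ℕ) : Measurable (truncEntry ε N) := by
  unfold truncEntry
  refine Measurable.ite ?_ (by fun_prop) measurable_const
  exact (measurableSet_le measurable_const measurable_maxAbs).inter
    (measurableSet_le measurable_maxAbs measurable_const)

lemma isHermitian_truncated {Ω : Type*} [MeasurableSpace Ω] {P : Measure Ω} {X : ℕ → ℕ → Ω → ℂ}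
    (hX : IsWigner P X) (ε : ℝ) (N : ℕ) (ω : Ω) : (truncated X ε N ω).IsHermitian := by
  ext i j
  rw [Matrix.conjTranspose_apply, truncated_apply, truncated_apply, hX.hermitian i j,
    truncEntry_conj]
  simp

lemma measurable_mu {Ω : Type*} [MeasurableSpace Ω] {P : Measure Ω} {X : ℕ → ℕ → Ω → ℂ}
    (hX : IsWigner P X) (ε : ℝ) (N : ℕ) : Measurable (mu X ε N) := by
  -- Continuity is only known on Hermitian matrices, so measurability goes through that subtype.
  have h1 : ContinuousOn (fun A : Fin N → Fin N → ℂ => outlier (topEigenvalue (Matrix.of A)))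
      {A | (Matrix.of A).IsHermitian} := continuousOn_outlier_topEigenvalue N
  have h2 : Measurable fun ω (i j : Fin N) => truncated X ε N ω i j :=
    measurable_pi_iff.2 fun i => measurable_pi_iff.2 fun j =>
      (measurable_truncEntry ε N).comp (hX.measurable i j)
  have h3 : Measurable fun ω =>
      (⟨fun i j => truncated X ε N ω i j, isHermitian_truncated hX ε N ω⟩ :
        {A : Fin N → Fin N → ℂ | (Matrix.of A).IsHermitian}) := h2.subtype_mk
  have h4 := (continuousOn_iff_continuous_domRestrict.1 h1).measurable
  convert h4.comp h3 using 1
  funext ω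
  rw [mu_eq_outlier, Function.comp_apply, Set.domRestrict_apply]
  congr 1

/-! ### Tail estimates for one entry -/

section Entry

variable {Ω : Type*} [MeasurableSpace Ω] {P : Measure Ω} {Z : Ω → ℂ} {α c : ℝ}
  {ν : Measure UnitCircle}

/-- Since `Real.log 0 = 0`, a vanishing tail would make the normalized logarithm `0`, against the
nonzero limit. -/
lemma HasTail.eventually_pos (h : HasTail P Z α c) (hc : 0 < c) :
    ∀ᶠ t : ℝ in atTop, 0 < P.real {ω | t < ‖Z ω‖} := by
  filter_upwards [h.eventually_ne hc.ne'] with t ht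
  refine lt_of_le_of_ne measureReal_nonneg fun h0 => ht ?_
  rw [← h0, Real.log_zero, mul_zero]

lemma neg_rpow_mul_eq {t : ℝ} (ht : 0 < t) (α l : ℝ) : l = -(-t ^ (-α) * l) * t ^ α := by
  rw [Real.rpow_neg ht.le]
  have := (Real.rpow_pos_of_pos ht α).ne'
  field_simp

lemma HasTail.eventually_le (h : HasTail P Z α c) (hc : 0 < c) {c' : ℝ} (hc' : c' < c) :
    ∀ᶠ t : ℝ in atTop, P.real {ω | t < ‖Z ω‖} ≤ Real.exp (-(c' * t ^ α)) := by
  filter_upwards [h.eventually_pos hc, h.eventually_const_lt hc', eventually_gt_atTop 0]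
    with t hpos hlt ht
  rw [← Real.log_le_iff_le_exp hpos, neg_rpow_mul_eq ht α (Real.log _), neg_mul, neg_le_neg_iff]
  exact mul_le_mul_of_nonneg_right hlt.le (Real.rpow_nonneg ht.le _)

lemma HasTail.le_eventually (h : HasTail P Z α c) (hc : 0 < c) {c' : ℝ} (hc' : c < c') :
    ∀ᶠ t : ℝ in atTop, Real.exp (-(c' * t ^ α)) ≤ P.real {ω | t < ‖Z ω‖} := by
  filter_upwards [h.eventually_pos hc, h.eventually_lt_const hc', eventually_gt_atTop 0]
    with t hpos hlt ht
  rw [← Real.le_log_iff_exp_le hpos, neg_rpow_mul_eq ht α (Real.log _), neg_mul, neg_le_neg_iff]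
  exact mul_le_mul_of_nonneg_right hlt.le (Real.rpow_nonneg ht.le _)

/-- Layer cake: for `θ < θ' < c` the variable exceeds `s` with probability at most `s ^ (-(θ' /
θ))`, an integrable power at infinity. -/
lemma HasTail.lintegral_exp_lt_top [IsProbabilityMeasure P] (h : HasTail P Z α c)
    (hZ : Measurable Z) (hα : 0 < α) (hc : 0 < c) {θ : ℝ} (hθ0 : 0 < θ) (hθ : θ < c) :
    ∫⁻ ω, ENNReal.ofReal (Real.exp (θ * ‖Z ω‖ ^ α)) ∂P < ∞ := by
  obtain ⟨θ', h1, h2⟩ := exists_between hθ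
  have hev : ∀ᶠ s : ℝ in atTop,
      P {ω | s < Real.exp (θ * ‖Z ω‖ ^ α)} ≤ ENNReal.ofReal (s ^ (-(θ' / θ))) := by
    have hlim : Tendsto (fun s : ℝ => (Real.log s / θ) ^ (α⁻¹)) atTop atTop :=
      (tendsto_rpow_atTop (inv_pos.2 hα)).comp (Real.tendsto_log_atTop.atTop_div_const hθ0)
    filter_upwards [hlim.eventually (h.eventually_le hc h2), eventually_gt_atTop 1] with s hs hs1
    have hlog : 0 ≤ Real.log s / θ := div_nonneg (Real.log_nonneg hs1.le) hθ0.le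
    have hset : {ω | s < Real.exp (θ * ‖Z ω‖ ^ α)} = {ω | (Real.log s / θ) ^ (α⁻¹) < ‖Z ω‖} := by
      ext ω
      simp only [Set.mem_ofPred_eq]
      rw [← Real.log_lt_iff_lt_exp (by linarith), Real.rpow_inv_lt_iff_of_pos hlog
        (norm_nonneg _) hα, div_lt_iff₀' hθ0]
    rw [hset, ← ofReal_measureReal (measure_ne_top _ _)]
    refine ENNReal.ofReal_le_ofReal (hs.trans_eq ?_)
    rw [Real.rpow_inv_rpow hlog hα.ne', Real.rpow_def_of_pos (by linarith)]
    congr 1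
    ring
  obtain ⟨S, hS⟩ := eventually_atTop.1 (hev.and (eventually_gt_atTop 0))
  have hS0 : 0 < S := (hS S le_rfl).2
  have hm : Measurable fun ω => Real.exp (θ * ‖Z ω‖ ^ α) := by fun_prop
  rw [lintegral_eq_lintegral_meas_lt P (Eventually.of_forall fun ω => (Real.exp_pos _).le)
    hm.aemeasurable, ← Set.Ioc_union_Ioi_eq_Ioi hS0.le]
  refine (lintegral_union_le _ _ _).trans_lt (ENNReal.add_lt_top.2 ⟨?_, ?_⟩)
  · calc ∫⁻ s in Set.Ioc 0 S, P {ω | s < Real.exp (θ * ‖Z ω‖ ^ α)}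
        ≤ ∫⁻ s in Set.Ioc 0 S, 1 := lintegral_mono fun s => prob_le_one
      _ < ∞ := by simp
  · calc ∫⁻ s in Set.Ioi S, P {ω | s < Real.exp (θ * ‖Z ω‖ ^ α)}
        ≤ ∫⁻ s in Set.Ioi S, ENNReal.ofReal (s ^ (-(θ' / θ))) :=
          setLIntegral_mono' measurableSet_Ioi fun s hs => (hS s (le_of_lt hs)).1
      _ < ∞ := by
        refine Integrable.lintegral_lt_top (integrableOn_Ioi_rpow_of_lt ?_ hS0)
        rw [neg_lt_neg_iff, lt_div_iff₀ hθ0]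
        linarith

lemma sqrt_natCast_rpow (N : ℕ) (α : ℝ) : √(N : ℝ) ^ α = (N : ℝ) ^ (α / 2) := by
  rw [Real.sqrt_eq_rpow, ← Real.rpow_mul (Nat.cast_nonneg N)]
  congr 1
  ring

lemma norm_truncEntry_le {ε : ℝ} {N : ℕ} (z : ℂ) : √(N : ℝ) * ‖truncEntry ε N z‖ ≤ ‖z‖ := by
  unfold truncEntry
  split_ifs with h
  · rw [norm_div, Complex.norm_real, Real.norm_of_nonneg (Real.sqrt_nonneg _)]
    rcases (Real.sqrt_nonneg (N : ℝ)).eq_or_lt with h0 | h0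
    · rw [← h0, zero_mul]
      exact norm_nonneg z
    · rw [mul_div_cancel₀ _ h0.ne']
  · simp

lemma le_norm_of_truncEntry_ne_zero {ε : ℝ} {N : ℕ} {z : ℂ} (h : truncEntry ε N z ≠ 0) :
    ε * √(N : ℝ) ≤ ‖z‖ := by
  unfold truncEntry at h
  split_ifs at h with h1
  · exact h1.1.trans (maxAbs_le_norm z)
  · exact absurd rfl h

/-- A surviving entry has `ε √N ≤ ‖Z‖`, so `exp (θ ‖Z‖ ^ α)` is at most `exp (θ' ‖Z‖ ^ α)` times the
small factor `exp (-(θ' - θ) ε ^ α N ^ (α / 2))`. Integrating gives both bounds. -/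
lemma HasTail.truncEntry_bounds [IsProbabilityMeasure P] (h : HasTail P Z α c)
    (hZ : Measurable Z) (hα : 0 < α) (hc : 0 < c) {ε : ℝ} (hε : 0 < ε) {θ : ℝ} (hθ0 : 0 < θ)
    (hθ : θ < c) :
    ∃ M : ℝ, 0 ≤ M ∧ ∃ κ : ℝ, 0 < κ ∧ ∀ N : ℕ,
      ∫⁻ ω, ENNReal.ofReal (Real.exp (θ * (N : ℝ) ^ (α / 2) * ‖truncEntry ε N (Z ω)‖ ^ α)) ∂P ≤
        ENNReal.ofReal (1 + M * Real.exp (-(κ * (N : ℝ) ^ (α / 2)))) ∧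
      P.real {ω | truncEntry ε N (Z ω) ≠ 0} ≤ M * Real.exp (-(κ * (N : ℝ) ^ (α / 2))) := by
  obtain ⟨θ', h1, h2⟩ := exists_between hθ
  have hfin := h.lintegral_exp_lt_top hZ hα hc (hθ0.trans h1) h2
  set I := ∫⁻ ω, ENNReal.ofReal (Real.exp (θ' * ‖Z ω‖ ^ α)) ∂P with hI
  have hκ : 0 < (θ' - θ) * ε ^ α := mul_pos (sub_pos.2 h1) (Real.rpow_pos_of_pos hε α)
  have hprod : ∀ N : ℕ, ENNReal.ofReal (I.toReal *
      Real.exp (-((θ' - θ) * ε ^ α * (N : ℝ) ^ (α / 2)))) =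
      ENNReal.ofReal (Real.exp (-((θ' - θ) * ε ^ α * (N : ℝ) ^ (α / 2)))) * I := fun N => by
    rw [ENNReal.ofReal_mul ENNReal.toReal_nonneg, ENNReal.ofReal_toReal hfin.ne, mul_comm]
  have key : ∀ (N : ℕ) (ω : Ω), truncEntry ε N (Z ω) ≠ 0 →
      Real.exp (θ * ‖Z ω‖ ^ α) ≤ Real.exp (-((θ' - θ) * ε ^ α * (N : ℝ) ^ (α / 2))) *
        Real.exp (θ' * ‖Z ω‖ ^ α) := by
    intro N ω hω
    rw [← Real.exp_add]
    refine Real.exp_le_exp.2 ?_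
    have hle := Real.rpow_le_rpow (by positivity) (le_norm_of_truncEntry_ne_zero hω) hα.le
    rw [Real.mul_rpow hε.le (Real.sqrt_nonneg _), sqrt_natCast_rpow] at hle
    have := mul_le_mul_of_nonneg_left hle (sub_pos.2 h1).le
    linarith
  refine ⟨I.toReal, ENNReal.toReal_nonneg, _, hκ, fun N => ⟨?_, ?_⟩⟩
  · calc ∫⁻ ω, ENNReal.ofReal (Real.exp (θ * (N : ℝ) ^ (α / 2) * ‖truncEntry ε N (Z ω)‖ ^ α)) ∂P
        ≤ ∫⁻ ω, (1 + ENNReal.ofReal (Real.exp (-((θ' - θ) * ε ^ α * (N : ℝ) ^ (α / 2)))) *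
            ENNReal.ofReal (Real.exp (θ' * ‖Z ω‖ ^ α))) ∂P := by
          refine lintegral_mono fun ω => ?_
          rw [← ENNReal.ofReal_mul (Real.exp_pos _).le]
          by_cases hω : truncEntry ε N (Z ω) = 0
          · simp [hω, Real.zero_rpow hα.ne']
          · refine le_add_left (ENNReal.ofReal_le_ofReal (le_trans ?_ (key N ω hω)))
            refine Real.exp_le_exp.2 ?_
            rw [mul_assoc, ← sqrt_natCast_rpow, ← Real.mul_rpow (Real.sqrt_nonneg _)
              (norm_nonneg _)]
            exact mul_le_mul_of_nonneg_left (Real.rpow_le_rpow (by positivity)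
              (norm_truncEntry_le _) hα.le) hθ0.le
      _ = 1 + ENNReal.ofReal (Real.exp (-((θ' - θ) * ε ^ α * (N : ℝ) ^ (α / 2)))) * I := by
          rw [lintegral_add_left measurable_const, lintegral_const_mul _ (by fun_prop), hI]
          simp
      _ = _ := by
          rw [ENNReal.ofReal_add zero_le_one (by positivity), hprod, ENNReal.ofReal_one]
  · refine ENNReal.toReal_le_of_le_ofReal (by positivity) ?_
    rw [hprod, hI, ← lintegral_const_mul _ (by fun_prop)]
    have hmeas : MeasurableSet {ω | truncEntry ε N (Z ω) ≠ 0} :=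
      ((measurable_truncEntry ε N).comp hZ) (measurableSet_singleton 0).compl
    rw [← lintegral_indicator_one hmeas]
    refine lintegral_mono fun ω => ?_
    by_cases hω : truncEntry ε N (Z ω) ≠ 0
    · rw [Set.indicator_of_mem (by exact hω), ← ENNReal.ofReal_mul (Real.exp_pos _).le,
        Pi.one_apply, ← ENNReal.ofReal_one]
      refine ENNReal.ofReal_le_ofReal (le_trans ?_ (key N ω hω))
      exact Real.one_le_exp (by positivity)
    · rw [Set.indicator_of_notMem (by exact hω)]
      exact zero_le

end Entry

/-! ### Directions of large entries -/

section Direction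

variable {Ω : Type*} [MeasurableSpace Ω] {P : Measure Ω} {Z : Ω → ℂ} {α c : ℝ}
  {ν : Measure UnitCircle}

/-- The complex numbers whose direction lies in the support of `ν` and whose two norms agree as soon
as the modulus is at least `t`. -/
def regularSet (ν : Measure UnitCircle) (t : ℝ) : Set ℂ :=
  {z | t ≤ ‖z‖ → z / (‖z‖ : ℂ) ∈ Subtype.val '' ν.support ∧ maxAbs z = ‖z‖}

lemma isClosed_image_support (ν : Measure UnitCircle) :
    IsClosed (Subtype.val '' ν.support : Set ℂ) :=
  Metric.isClosed_sphere.isClosedEmbedding_subtypeVal.isClosedMap _ Measure.isClosed_support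

lemma measurableSet_regularSet (ν : Measure UnitCircle) (t : ℝ) :
    MeasurableSet (regularSet ν t) := by
  have h1 : MeasurableSet {z : ℂ | t ≤ ‖z‖} := measurableSet_le measurable_const measurable_norm
  have h2 : MeasurableSet {z : ℂ | z / (‖z‖ : ℂ) ∈ Subtype.val '' ν.support} := by
    have : Measurable fun z : ℂ => z / (‖z‖ : ℂ) := by fun_prop
    exact this (isClosed_image_support ν).measurableSet
  have h3 : MeasurableSet {z : ℂ | maxAbs z = ‖z‖} :=
    measurableSet_eq_fun measurable_maxAbs measurable_norm
  exact h1.imp (h2.inter h3)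

lemma regularSet_mono (ν : Measure UnitCircle) {s t : ℝ} (h : s ≤ t) :
    regularSet ν s ⊆ regularSet ν t := fun _ hz ht => hz (h.trans ht)

lemma norm_div_norm_eq_one {z : ℂ} (hz : z ≠ 0) : ‖z / (‖z‖ : ℂ)‖ = 1 := by
  rw [norm_div, Complex.norm_real, norm_norm, div_self (norm_ne_zero_iff.2 hz)]

lemma maxAbs_real_mul {r : ℝ} (hr : 0 ≤ r) (z : ℂ) : maxAbs (r * z) = r * maxAbs z := by
  simp only [maxAbs, Complex.re_ofReal_mul, Complex.im_ofReal_mul, abs_mul, abs_of_nonneg hr,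
    mul_max_of_nonneg _ _ hr]

lemma AngleDecoupled.ae_mem_image_support (h : AngleDecoupled P Z ν) :
    ∃ t : ℝ, 0 < t ∧ ∀ᵐ ω ∂P, t ≤ ‖Z ω‖ → Z ω / (‖Z ω‖ : ℂ) ∈ Subtype.val '' ν.support := by
  obtain ⟨t, ht, h⟩ := h
  refine ⟨t, ht, ?_⟩
  have h0 := h t le_rfl ν.supportᶜ Measure.isOpen_compl_support.measurableSet
  rw [Measure.measure_compl_support, zero_mul] at h0
  rw [ae_iff]
  refine measure_mono_null (fun ω hω => ?_) h0
  simp only [Set.mem_ofPred_eq, Classical.not_imp] at hω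
  have hne : Z ω ≠ 0 := norm_pos_iff.1 (ht.trans_le hω.1)
  refine ⟨⟨⟨Z ω / (‖Z ω‖ : ℂ), by
    rw [mem_sphere_zero_iff_norm, norm_div_norm_eq_one hne]⟩, fun hmem => ?_, rfl⟩, hω.1⟩
  exact hω.2 ⟨_, hmem, rfl⟩

/-- Here `α < 2` enters: numbers in `(0, 1)` grow when the exponent `2` is lowered to `α`. Thus two
large independent coordinates cost strictly more than one large modulus. -/
lemma one_lt_rpow_add_rpow {x y : ℝ} (hx : 0 < x) (hy : 0 < y) (hxy : x ^ 2 + y ^ 2 = 1)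
    (hα : α < 2) : 1 < x ^ α + y ^ α := by
  have hx1 : x < 1 := by nlinarith [sq_nonneg (x - 1)]
  have hy1 : y < 1 := by nlinarith [sq_nonneg (y - 1)]
  rw [← hxy, ← Real.rpow_two, ← Real.rpow_two]
  exact add_lt_add (Real.rpow_lt_rpow_of_exponent_gt hx hx1 hα)
    (Real.rpow_lt_rpow_of_exponent_gt hy hy1 hα)

lemma tendsto_exp_neg_mul_rpow (hα : 0 < α) {d : ℝ} (hd : 0 < d) :
    Tendsto (fun t : ℝ => Real.exp (-(d * t ^ α))) atTop (𝓝 0) :=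
  Real.tendsto_exp_neg_atTop_nhds_zero.comp ((tendsto_rpow_atTop hα).const_mul_atTop hd)

/-- If the real and imaginary parts are independent and the tail is heavier than Gaussian, the
limiting directions lie on the coordinate axes. -/
lemma AngleDecoupled.re_eq_zero_or_im_eq_zero [IsProbabilityMeasure P] [IsProbabilityMeasure ν]
    (hang : AngleDecoupled P Z ν) (htail : HasTail P Z α c) (hα0 : 0 < α) (hα : α < 2)
    (hc : 0 < c) (hind : IndepFun (fun ω => (Z ω).re) (fun ω => (Z ω).im) P) {u : UnitCircle}
    (hu : u ∈ ν.support) : (u : ℂ).re = 0 ∨ (u : ℂ).im = 0 := by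
  by_contra! hne
  set x := |(u : ℂ).re| with hxdef
  set y := |(u : ℂ).im| with hydef
  have hx : 0 < x := abs_pos.2 hne.1
  have hy : 0 < y := abs_pos.2 hne.2
  have hxy : x ^ 2 + y ^ 2 = 1 := by
    have h1 : ‖(u : ℂ)‖ = 1 := by simp
    have h2 := Complex.sq_norm (u : ℂ)
    rw [h1, Complex.normSq_apply] at h2
    rw [sq_abs, sq_abs]
    linarith
  have hS := one_lt_rpow_add_rpow hx hy hxy hα
  -- At `κ = 1` the inequality reads `1 < x ^ α + y ^ α`, so it persists slightly below. The factor
  -- `κ ^ α` pays for widening the set of directions, `κ` for lowering the rate `c` in upper tail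
  -- bounds, and `2 - κ` for raising it in the lower one.
  obtain ⟨κ, hκ, hκ0, hκ1⟩ : ∃ κ : ℝ, 0 < κ * κ ^ α * (x ^ α + y ^ α) - (2 - κ) ∧
      0 < κ ∧ κ < 1 := by
    have hcont : ContinuousAt (fun κ : ℝ => κ * κ ^ α * (x ^ α + y ^ α) - (2 - κ)) 1 := by
      have : ContinuousAt (fun κ : ℝ => κ ^ α) 1 :=
        continuousAt_id.rpow_const (Or.inl one_ne_zero)
      fun_prop
    have hev : ∀ᶠ κ : ℝ in 𝓝 1, 0 < κ * κ ^ α * (x ^ α + y ^ α) - (2 - κ) :=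
      hcont.eventually_const_lt (by norm_num; linarith)
    have hev' : ∀ᶠ κ : ℝ in 𝓝[<] 1, 0 < κ * κ ^ α * (x ^ α + y ^ α) - (2 - κ) ∧ 0 < κ ∧ κ < 1 :=
      (hev.filter_mono nhdsWithin_le_nhds).and
        (((eventually_gt_nhds one_pos).filter_mono nhdsWithin_le_nhds).and self_mem_nhdsWithin)
    exact hev'.exists
  obtain ⟨t₀, ht₀, hdec⟩ := hang
  set U : Set UnitCircle := {v | κ * x < |(v : ℂ).re| ∧ κ * y < |(v : ℂ).im|} with hU
  have hUo : IsOpen U := by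
    have h1 : IsOpen {v : UnitCircle | κ * x < |(v : ℂ).re|} :=
      isOpen_lt continuous_const (by fun_prop)
    have h2 : IsOpen {v : UnitCircle | κ * y < |(v : ℂ).im|} :=
      isOpen_lt continuous_const (by fun_prop)
    exact h1.inter h2
  have hUpos : 0 < ν.real U := by
    refine ENNReal.toReal_pos ?_ (measure_ne_top _ _)
    refine ((Measure.mem_support_iff_forall u).1 hu U (hUo.mem_nhds ?_)).ne'
    exact ⟨mul_lt_of_lt_one_left hx hκ1, mul_lt_of_lt_one_left hy hκ1⟩
  -- A modulus at least `t` with direction in `U` makes both coordinates large, and independence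
  -- factors that event.
  have hbound : ∀ t : ℝ, t₀ ≤ t → ν.real U * P.real {ω | t < ‖Z ω‖} ≤
      P.real {ω | κ * x * t < ‖Z ω‖} * P.real {ω | κ * y * t < ‖Z ω‖} := by
    intro t ht
    have ht' : 0 < t := ht₀.trans_le ht
    have e1 := congrArg ENNReal.toReal (hdec t ht U hUo.measurableSet)
    rw [ENNReal.toReal_mul] at e1
    calc ν.real U * P.real {ω | t < ‖Z ω‖} ≤ ν.real U * P.real {ω | t ≤ ‖Z ω‖} := by
          refine mul_le_mul_of_nonneg_left (measureReal_mono fun ω hω => ?_) hUpos.le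
          exact (show t < ‖Z ω‖ from hω).le
      _ = P.real {ω | Z ω / (‖Z ω‖ : ℂ) ∈ Subtype.val '' U ∧ t ≤ ‖Z ω‖} := e1.symm
      _ ≤ P.real ((fun ω => (Z ω).re) ⁻¹' {r | κ * x * t < |r|} ∩
            (fun ω => (Z ω).im) ⁻¹' {r | κ * y * t < |r|}) := by
          refine measureReal_mono fun ω hω => ?_
          obtain ⟨⟨v, ⟨hv1, hv2⟩, hv⟩, hω⟩ := hω
          have hpos : 0 < ‖Z ω‖ := ht'.trans_le hω
          have hZ : Z ω = (‖Z ω‖ : ℂ) * v := by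
            rw [hv, mul_div_cancel₀]
            exact_mod_cast hpos.ne'
          have hre : |(Z ω).re| = ‖Z ω‖ * |(v : ℂ).re| := by
            conv_lhs => rw [hZ]
            rw [Complex.re_ofReal_mul, abs_mul, abs_of_pos hpos]
          have him : |(Z ω).im| = ‖Z ω‖ * |(v : ℂ).im| := by
            conv_lhs => rw [hZ]
            rw [Complex.im_ofReal_mul, abs_mul, abs_of_pos hpos]
          constructor
          · change κ * x * t < |(Z ω).re|
            rw [hre, mul_comm ‖Z ω‖]
            exact mul_lt_mul hv1 hω ht' (abs_nonneg _)
          · change κ * y * t < |(Z ω).im|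
            rw [him, mul_comm ‖Z ω‖]
            exact mul_lt_mul hv2 hω ht' (abs_nonneg _)
      _ = P.real ((fun ω => (Z ω).re) ⁻¹' {r | κ * x * t < |r|}) *
            P.real ((fun ω => (Z ω).im) ⁻¹' {r | κ * y * t < |r|}) := by
          have hm : ∀ s : ℝ, MeasurableSet {r : ℝ | s < |r|} := fun s =>
            measurableSet_lt measurable_const measurable_norm
          rw [measureReal_def, hind.measure_inter_preimage_eq_mul _ _ (hm _) (hm _),
            ENNReal.toReal_mul]
          rfl
      _ ≤ _ := by
          refine mul_le_mul (measureReal_mono fun ω hω => ?_) (measureReal_mono fun ω hω => ?_)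
            measureReal_nonneg measureReal_nonneg
          · exact lt_of_lt_of_le hω (Complex.abs_re_le_norm _)
          · exact lt_of_lt_of_le hω (Complex.abs_im_le_norm _)
  have hgap : 0 < c * (κ * κ ^ α * (x ^ α + y ^ α) - (2 - κ)) := mul_pos hc hκ
  have hlow := htail.le_eventually hc (show c < c * (2 - κ) by nlinarith)
  have hup : ∀ {s : ℝ}, 0 < s → ∀ᶠ t : ℝ in atTop,
      P.real {ω | s * t < ‖Z ω‖} ≤ Real.exp (-(c * κ * (s * t) ^ α)) := fun hs =>
    (tendsto_id.const_mul_atTop hs).eventually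
      (htail.eventually_le hc (show c * κ < c by nlinarith))
  -- The fixed positive mass `ν.real U` would lie below a quantity tending to `0`.
  have hfinal : ∀ᶠ t : ℝ in atTop, ν.real U ≤
      Real.exp (-(c * (κ * κ ^ α * (x ^ α + y ^ α) - (2 - κ)) * t ^ α)) := by
    filter_upwards [hlow, hup (mul_pos hκ0 hx), hup (mul_pos hκ0 hy), eventually_ge_atTop t₀]
      with t h1 h2 h3 ht
    have ht' : 0 < t := ht₀.trans_le ht
    have h4 := (mul_le_mul_of_nonneg_left h1 hUpos.le).trans ((hbound t ht).trans
      (mul_le_mul h2 h3 measureReal_nonneg (Real.exp_pos _).le))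
    rw [← le_div_iff₀ (Real.exp_pos _), ← Real.exp_add, ← Real.exp_sub] at h4
    refine h4.trans_eq (congrArg Real.exp ?_)
    rw [Real.mul_rpow (by positivity) ht'.le, Real.mul_rpow (by positivity) ht'.le,
      Real.mul_rpow hκ0.le hx.le, Real.mul_rpow hκ0.le hy.le]
    ring
  exact absurd (ge_of_tendsto (tendsto_exp_neg_mul_rpow hα0 hgap) hfinal) (not_le.2 hUpos)

lemma maxAbs_eq_norm_of_re_eq_zero_or_im_eq_zero {z : ℂ} (h : z.re = 0 ∨ z.im = 0) :
    maxAbs z = ‖z‖ := by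
  rcases h with h | h
  · rw [Complex.abs_im_eq_norm.2 h |>.symm, maxAbs, h, abs_zero, max_eq_right (abs_nonneg _)]
  · rw [Complex.abs_re_eq_norm.2 h |>.symm, maxAbs, h, abs_zero, max_eq_left (abs_nonneg _)]

lemma AngleDecoupled.ae_mem_regularSet_of_indep [IsProbabilityMeasure P] [IsProbabilityMeasure ν]
    (hang : AngleDecoupled P Z ν) (htail : HasTail P Z α c) (hα0 : 0 < α) (hα : α < 2)
    (hc : 0 < c) (hind : IndepFun (fun ω => (Z ω).re) (fun ω => (Z ω).im) P) :
    ∃ t : ℝ, 0 < t ∧ ∀ᵐ ω ∂P, Z ω ∈ regularSet ν t := by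
  obtain ⟨t, ht, h⟩ := hang.ae_mem_image_support
  refine ⟨t, ht, h.mono fun ω hω htω => ⟨hω htω, ?_⟩⟩
  obtain ⟨v, hv, hvZ⟩ := hω htω
  have hpos : 0 < ‖Z ω‖ := ht.trans_le htω
  have hZ : Z ω = (‖Z ω‖ : ℂ) * v := by
    rw [hvZ, mul_div_cancel₀]
    exact_mod_cast hpos.ne'
  have hv1 : ‖(v : ℂ)‖ = 1 := by simp
  conv_lhs => rw [hZ]
  rw [maxAbs_real_mul hpos.le, maxAbs_eq_norm_of_re_eq_zero_or_im_eq_zero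
    (hang.re_eq_zero_or_im_eq_zero htail hα0 hα hc hind hv), hv1, mul_one]

lemma AngleDecoupled.ae_mem_regularSet_of_im_eq_zero (hang : AngleDecoupled P Z ν)
    (him : ∀ ω, (Z ω).im = 0) : ∃ t : ℝ, 0 < t ∧ ∀ᵐ ω ∂P, Z ω ∈ regularSet ν t := by
  obtain ⟨t, ht, h⟩ := hang.ae_mem_image_support
  exact ⟨t, ht, h.mono fun ω hω htω =>
    ⟨hω htω, maxAbs_eq_norm_of_re_eq_zero_or_im_eq_zero (Or.inr (him ω))⟩⟩

/-- Once `t ≤ ε √N`, every surviving entry is in the range where `maxAbs` and the modulus agree. -/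
lemma truncEntry_of_mem_regularSet {ε t : ℝ} (hε : 0 < ε) {N : ℕ} (ht : 0 < t)
    (hN : t ≤ ε * √(N : ℝ)) {z : ℂ} (hz : z ∈ regularSet ν t) :
    truncEntry ε N z = 0 ∨ (ε ≤ ‖truncEntry ε N z‖ ∧ ‖truncEntry ε N z‖ ≤ ε⁻¹ ∧
      truncEntry ε N z / (‖truncEntry ε N z‖ : ℂ) ∈ Subtype.val '' ν.support) := by
  by_cases h0 : truncEntry ε N z = 0
  · exact Or.inl h0
  have hsqrt : 0 < √(N : ℝ) := pos_of_mul_pos_right (ht.trans_le hN) hε.le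
  have hz1 := le_norm_of_truncEntry_ne_zero h0
  obtain ⟨hdir, hmax⟩ := hz (hN.trans hz1)
  unfold truncEntry at h0 ⊢
  split_ifs at h0 ⊢ with h
  · right
    rw [hmax] at h
    have hnorm : ‖z / (√(N : ℝ) : ℂ)‖ = ‖z‖ / √(N : ℝ) := by
      rw [norm_div, Complex.norm_real, Real.norm_of_nonneg hsqrt.le]
    rw [hnorm]
    refine ⟨(le_div_iff₀ hsqrt).2 h.1, (div_le_iff₀ hsqrt).2 h.2, ?_⟩
    push_cast
    rwa [div_div_div_cancel_right₀ (by exact_mod_cast hsqrt.ne')]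
  · exact absurd rfl h0

end Direction

/-! ### Lower bound for one entry near a prescribed value -/

lemma tendsto_natCast_rpow {α : ℝ} (hα : 0 < α) :
    Tendsto (fun N : ℕ => (N : ℝ) ^ (α / 2)) atTop atTop :=
  (tendsto_rpow_atTop (half_pos hα)).comp tendsto_natCast_atTop_atTop

lemma tendsto_mul_sqrt_natCast {s : ℝ} (hs : 0 < s) :
    Tendsto (fun N : ℕ => s * √(N : ℝ)) atTop atTop :=
  (Real.tendsto_sqrt_atTop.comp tendsto_natCast_atTop_atTop).const_mul_atTop hs

section LocalLowerBound

variable {Ω : Type*} [MeasurableSpace Ω] {P : Measure Ω} {Z : Ω → ℂ} {α c : ℝ}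
  {ν : Measure UnitCircle}

/-- A sub-interval of `(ε, ε⁻¹)` on which `ρ` is close to `r`, and the corresponding exponents. -/
lemma exists_interval_near {ε : ℝ} (hε : 0 < ε) (hε1 : ε < 1) (hα : 0 < α)
    {r δ η : ℝ} (hr : r ∈ Set.Icc ε ε⁻¹) (hδ : 0 < δ) (hη : 0 < η) :
    ∃ s s' : ℝ, ε < s ∧ s < s' ∧ s' < ε⁻¹ ∧ (∀ ρ ∈ Set.Icc s s', |ρ - r| < δ) ∧
      c * s ^ α < c * r ^ α + η := by
  have hlt : ε < ε⁻¹ := hε1.trans ((one_lt_inv₀ hε).2 hε1)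
  have hV : ∀ᶠ ρ in 𝓝 r, |ρ - r| < δ ∧ c * ρ ^ α < c * r ^ α + η := by
    refine Eventually.and ?_ ?_
    · exact Metric.eventually_nhds_iff.2 ⟨δ, hδ, fun ρ h => h⟩
    · have : ContinuousAt (fun ρ : ℝ => c * ρ ^ α) r :=
        (Real.continuousAt_rpow_const r α (Or.inr hα.le)).const_mul c
      exact this.eventually_lt_const (by linarith)
  obtain ⟨V, hVsub, hVo, hrV⟩ := eventually_nhds_iff.1 hV
  -- As `r` may be an endpoint of `[ε, ε⁻¹]`, it is approximated from the open interval, leaving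
  -- room for a nondegenerate interval.
  rw [← closure_Ioo hlt.ne] at hr
  obtain ⟨p, hpV, hp1, hp2⟩ := mem_closure_iff.1 hr V hVo hrV
  have hmem : ∀ᶠ ρ in 𝓝 p, ρ ∈ V ∧ ρ < ε⁻¹ := 
    (hVo.eventually_mem hpV).and (eventually_lt_nhds hp2)
  obtain ⟨d, hd, hball⟩ := Metric.eventually_nhds_iff.1 hmem
  have hclose : ∀ ρ ∈ Set.Icc p (p + d / 2), ρ ∈ V ∧ ρ < ε⁻¹ := fun ρ hρ => hball (by
    rw [Real.dist_eq, abs_of_nonneg (sub_nonneg.2 hρ.1)]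
    linarith [hρ.2])
  exact ⟨p, p + d / 2, hp1, by linarith, (hclose _ ⟨by linarith, le_rfl⟩).2,
    fun ρ hρ => (hVsub ρ (hclose ρ hρ).1).1, (hVsub p hpV).2⟩

lemma HasTail.eventually_shell_lower [IsProbabilityMeasure P] (htail : HasTail P Z α c)
    (hα : 0 < α) (hc : 0 < c) {s s' B q : ℝ} (hs : 0 < s) (hss : s < s') (hB : c * s ^ α < B)
    (hq : 0 < q) :
    ∀ᶠ N : ℕ in atTop, Real.exp (-(B * (N : ℝ) ^ (α / 2))) ≤
      q * (P.real {ω | s * √(N : ℝ) ≤ ‖Z ω‖} - P.real {ω | s' * √(N : ℝ) ≤ ‖Z ω‖}) := by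
  -- The intermediate radius turns the closed event at `s'` into a strict tail. With `A₁ < A₂`, the
  -- tail at `s` exceeds that at `s'` by a factor growing like `exp ((A₂ - A₁) v)`, which also beats
  -- the constant `1 / q`.
  obtain ⟨s'', h1, h2⟩ := exists_between hss
  have hs'' : 0 < s'' := hs.trans h1
  have hpow : c * s ^ α < c * s'' ^ α :=
    mul_lt_mul_of_pos_left (Real.rpow_lt_rpow hs.le h1 hα) hc
  obtain ⟨A₁, hA1, hA⟩ := exists_between (lt_min hB hpow)
  obtain ⟨A₂, hA2, hA3⟩ := exists_between hA
  have e1 : c < A₁ / s ^ α := (lt_div_iff₀ (Real.rpow_pos_of_pos hs α)).2 hA1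
  have e2 : A₂ / s'' ^ α < c :=
    (div_lt_iff₀ (Real.rpow_pos_of_pos hs'' α)).2 (hA3.trans_le (min_le_right _ _))
  have hlow := (tendsto_mul_sqrt_natCast hs).eventually (htail.le_eventually hc e1)
  have hup := (tendsto_mul_sqrt_natCast hs'').eventually (htail.eventually_le hc e2)
  have hbig : ∀ᶠ N : ℕ in atTop, 1 + 1 / q ≤ Real.exp ((A₂ - A₁) * (N : ℝ) ^ (α / 2)) :=
    (Real.tendsto_exp_atTop.comp ((tendsto_natCast_rpow hα).const_mul_atTop
      (sub_pos.2 hA2))).eventually_ge_atTop _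
  filter_upwards [hlow, hup, hbig, eventually_gt_atTop 0] with N h3 h4 h5 hN
  have hN' : 0 < √(N : ℝ) := Real.sqrt_pos.2 (Nat.cast_pos.2 hN)
  rw [Real.mul_rpow hs.le hN'.le, sqrt_natCast_rpow, ← mul_assoc,
    div_mul_cancel₀ _ (Real.rpow_pos_of_pos hs α).ne'] at h3
  rw [Real.mul_rpow hs''.le hN'.le, sqrt_natCast_rpow, ← mul_assoc,
    div_mul_cancel₀ _ (Real.rpow_pos_of_pos hs'' α).ne'] at h4
  have h6 : P.real {ω | s * √(N : ℝ) < ‖Z ω‖} ≤ P.real {ω | s * √(N : ℝ) ≤ ‖Z ω‖} :=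
    measureReal_mono fun ω hω => (show s * √(N : ℝ) < ‖Z ω‖ from hω).le
  have h7 : P.real {ω | s' * √(N : ℝ) ≤ ‖Z ω‖} ≤ P.real {ω | s'' * √(N : ℝ) < ‖Z ω‖} :=
    measureReal_mono fun ω hω => (mul_lt_mul_of_pos_right h2 hN').trans_le hω
  set v := (N : ℝ) ^ (α / 2)
  have hv : 0 ≤ v := Real.rpow_nonneg (Nat.cast_nonneg N) _
  have h8 : Real.exp (-(A₁ * v)) = Real.exp ((A₂ - A₁) * v) * Real.exp (-(A₂ * v)) := by
    rw [← Real.exp_add]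
    congr 1
    ring
  have h9 : 1 / q * Real.exp (-(A₂ * v)) ≤
      P.real {ω | s * √(N : ℝ) ≤ ‖Z ω‖} - P.real {ω | s' * √(N : ℝ) ≤ ‖Z ω‖} := by
    have := mul_le_mul_of_nonneg_right h5 (Real.exp_pos (-(A₂ * v))).le
    linarith
  have h10 : Real.exp (-(B * v)) ≤ Real.exp (-(A₂ * v)) :=
    Real.exp_le_exp.2 (neg_le_neg (mul_le_mul_of_nonneg_right
      (hA3.le.trans (min_le_left _ _)) hv))
  refine h10.trans ?_
  have := mul_le_mul_of_nonneg_left h9 hq.le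
  rwa [← mul_assoc, mul_one_div_cancel hq.ne', one_mul] at this

lemma AngleDecoupled.eventually_truncEntry_near [IsProbabilityMeasure P] [IsProbabilityMeasure ν]
    (hang : AngleDecoupled P Z ν) (htail : HasTail P Z α c) (hα : 0 < α)
    (hc : 0 < c) {t : ℝ} (hreg : ∀ᵐ ω ∂P, Z ω ∈ regularSet ν t) {ε : ℝ} (hε : 0 < ε)
    (hε1 : ε < 1) {w : ℂ} (hw1 : ε ≤ ‖w‖) (hw2 : ‖w‖ ≤ ε⁻¹)
    (hw : w / (‖w‖ : ℂ) ∈ Subtype.val '' ν.support) {δ η : ℝ} (hδ : 0 < δ) (hη : 0 < η) :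
    ∀ᶠ N : ℕ in atTop, Real.exp (-((c * ‖w‖ ^ α + η) * (N : ℝ) ^ (α / 2))) ≤
      P.real {ω | ‖truncEntry ε N (Z ω) - w‖ < δ} := by
  obtain ⟨u, hu, huw⟩ := hw
  obtain ⟨s, s', hs, hss, hs', hnear, hcost⟩ :=
    exists_interval_near (c := c) hε hε1 hα ⟨hw1, hw2⟩ (half_pos hδ) hη
  have hs0 : 0 < s := hε.trans hs
  obtain ⟨t₀, ht₀, hdec⟩ := hang
  -- The factor `ε` in the radius compensates for moduli up to `ε⁻¹`, so the angular error stays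
  -- below `δ / 2`.
  set U : Set UnitCircle := {v | ‖(v : ℂ) - u‖ < δ / 2 * ε} with hU
  have hUo : IsOpen U := isOpen_lt (by fun_prop) continuous_const
  have hUpos : 0 < ν.real U := by
    refine ENNReal.toReal_pos ?_ (measure_ne_top _ _)
    refine ((Measure.mem_support_iff_forall u).1 hu U (hUo.mem_nhds ?_)).ne'
    change ‖(u : ℂ) - u‖ < δ / 2 * ε
    rw [sub_self, norm_zero]
    positivity
  filter_upwards [htail.eventually_shell_lower hα hc hs0 hss hcost hUpos,
    (tendsto_mul_sqrt_natCast hs0).eventually_ge_atTop t₀,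
    (tendsto_mul_sqrt_natCast hs0).eventually_ge_atTop t, eventually_gt_atTop 0] with N h1 h2 h3 hN
  have hN' : 0 < √(N : ℝ) := Real.sqrt_pos.2 (Nat.cast_pos.2 hN)
  have hss' : s * √(N : ℝ) ≤ s' * √(N : ℝ) := mul_le_mul_of_nonneg_right hss.le hN'.le
  refine h1.trans ?_
  have e1 : P.real {ω | Z ω / (‖Z ω‖ : ℂ) ∈ Subtype.val '' U ∧ s * √(N : ℝ) ≤ ‖Z ω‖} =
      ν.real U * P.real {ω | s * √(N : ℝ) ≤ ‖Z ω‖} := by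
    simpa [measureReal_def] using congrArg ENNReal.toReal (hdec _ h2 U hUo.measurableSet)
  have e2 : P.real {ω | Z ω / (‖Z ω‖ : ℂ) ∈ Subtype.val '' U ∧ s' * √(N : ℝ) ≤ ‖Z ω‖} =
      ν.real U * P.real {ω | s' * √(N : ℝ) ≤ ‖Z ω‖} := by
    simpa [measureReal_def] using
      congrArg ENNReal.toReal (hdec _ (h2.trans hss') U hUo.measurableSet)
  -- The decoupling hypothesis only concerns events `t ≤ ‖Z‖`, so a shell is reached as a difference
  -- of two of them.
  rw [mul_sub, ← e1, ← e2, sub_le_iff_le_add]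
  set E := {ω | ‖truncEntry ε N (Z ω) - w‖ < δ} with hE
  have hcover : ∀ᵐ ω ∂P,
      ω ∈ {ω | Z ω / (‖Z ω‖ : ℂ) ∈ Subtype.val '' U ∧ s * √(N : ℝ) ≤ ‖Z ω‖} →
      ω ∈ E ∪ {ω | Z ω / (‖Z ω‖ : ℂ) ∈ Subtype.val '' U ∧ s' * √(N : ℝ) ≤ ‖Z ω‖} := by
    filter_upwards [hreg] with ω hω
    rintro ⟨hdir, hge⟩
    by_cases hlt : s' * √(N : ℝ) ≤ ‖Z ω‖
    · exact Or.inr ⟨hdir, hlt⟩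
    left
    change ‖truncEntry ε N (Z ω) - w‖ < δ
    have hmax := (hω (h3.trans hge)).2
    obtain ⟨v, hvU, hv⟩ := hdir
    have hvU' : ‖(v : ℂ) - u‖ < δ / 2 * ε := hvU
    have hpos : 0 < ‖Z ω‖ := (mul_pos hs0 hN').trans_le hge
    set ρ := ‖Z ω‖ / √(N : ℝ) with hρ
    have hρ1 : s ≤ ρ := (le_div_iff₀ hN').2 hge
    have hρ2 : ρ ≤ s' := (div_le_iff₀ hN').2 (not_le.1 hlt).le
    have hval : truncEntry ε N (Z ω) = (ρ : ℂ) * v := by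
      unfold truncEntry
      rw [hmax, if_pos]
      · rw [hv, hρ]
        have h5 : (‖Z ω‖ : ℂ) ≠ 0 := by exact_mod_cast hpos.ne'
        push_cast
        field_simp
      · refine ⟨(mul_le_mul_of_nonneg_right hs.le hN'.le).trans hge, (not_le.1 hlt).le.trans ?_⟩
        exact mul_le_mul_of_nonneg_right hs'.le hN'.le
    have hwval : w = (‖w‖ : ℂ) * u := by
      rw [huw, mul_div_cancel₀]
      exact_mod_cast (hε.trans_le hw1).ne'
    have hρ0 : 0 < ρ := hs0.trans_le hρ1
    calc ‖truncEntry ε N (Z ω) - w‖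
        = ‖(ρ : ℂ) * ((v : ℂ) - u) + ((ρ - ‖w‖ : ℝ) : ℂ) * u‖ := by
          rw [hval]
          conv_lhs => rw [hwval]
          congr 1
          push_cast
          ring
      _ ≤ ρ * ‖(v : ℂ) - u‖ + |ρ - ‖w‖| := by
          refine (norm_add_le _ _).trans (le_of_eq ?_)
          rw [norm_mul, norm_mul, Complex.norm_real, Complex.norm_real, Real.norm_of_nonneg hρ0.le,
            Real.norm_eq_abs]
          simp
      _ < δ / 2 + δ / 2 := by
          refine add_lt_add_of_le_of_lt ?_ (hnear ρ ⟨hρ1, hρ2⟩)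
          calc ρ * ‖(v : ℂ) - u‖ ≤ ε⁻¹ * (δ / 2 * ε) :=
                mul_le_mul (hρ2.trans hs'.le) hvU'.le (norm_nonneg _) (by positivity)
            _ = δ / 2 := by field_simp
      _ = δ := add_halves δ
  exact (ENNReal.toReal_mono (measure_ne_top _ _) (measure_mono_ae hcover)).trans (measureReal_union_le _ _)

end LocalLowerBound

/-! ### The cost as a sum over independent entries -/

/-- The cost of a matrix, without the admissibility constraint. -/
noncomputable def entryCost (α a b : ℝ) {n : ℕ} (A : Matrix (Fin n) (Fin n) ℂ) : ℝ :=
  b * ∑ i, ‖A i i‖ ^ α + a * ∑ p : Fin n × Fin n with p.1 < p.2, ‖A p.1 p.2‖ ^ α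

/-- The indices of the entries on or above the diagonal. -/
abbrev UpperIndex : Type := {p : ℕ × ℕ // p.1 ≤ p.2}

/-- The indices of the entries on or above the diagonal of a matrix of size `N`. -/
def upperIndices (N : ℕ) : Finset UpperIndex :=
  (Finset.range N ×ˢ Finset.range N).subtype fun p => p.1 ≤ p.2

/-- The rate of the tail of an entry. -/
noncomputable def weight (a b : ℝ) (p : UpperIndex) : ℝ := if p.1.1 = p.1.2 then b else a

lemma mem_upperIndices {N : ℕ} {p : UpperIndex} : p ∈ upperIndices N ↔ p.1.2 < N := by
  simp only [upperIndices, Finset.mem_subtype, Finset.mem_product, Finset.mem_range]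
  exact ⟨fun h => h.2, fun h => ⟨p.2.trans_lt h, h⟩⟩

lemma upperIndices_mono {m n : ℕ} (h : m ≤ n) : upperIndices m ⊆ upperIndices n := fun _ hp =>
  mem_upperIndices.2 ((mem_upperIndices.1 hp).trans_le h)

lemma card_upperIndices_le (N : ℕ) : (upperIndices N).card ≤ N ^ 2 := by
  rw [upperIndices, Finset.card_subtype]
  refine (Finset.card_filter_le _ _).trans (le_of_eq ?_)
  rw [Finset.card_product, Finset.card_range, sq]

lemma sum_upperIndices (N : ℕ) (g : ℕ → ℕ → ℝ) :
    ∑ p ∈ upperIndices N, g p.1.1 p.1.2 =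
      ∑ i : Fin N, ∑ j : Fin N, if i ≤ j then g i j else 0 := by
  rw [upperIndices, Finset.sum_subtype_eq_sum_filter (f := fun p : ℕ × ℕ => g p.1 p.2),
    Finset.sum_filter, Finset.sum_product, ← Fin.sum_univ_eq_sum_range
      (fun i => ∑ j ∈ Finset.range N, if i ≤ j then g i j else 0)]
  refine Finset.sum_congr rfl fun i _ => ?_
  rw [← Fin.sum_univ_eq_sum_range (fun j => if (i : ℕ) ≤ j then g i j else 0)]
  rfl

lemma entryCost_eq_sum (α a b : ℝ) {n : ℕ} (F : ℕ → ℕ → ℂ) :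
    entryCost α a b (Matrix.of fun i j : Fin n => F i j) =
      ∑ p ∈ upperIndices n, weight a b p * ‖F p.1.1 p.1.2‖ ^ α := by
  rw [show (∑ p ∈ upperIndices n, weight a b p * ‖F p.1.1 p.1.2‖ ^ α) =
      ∑ p ∈ upperIndices n, (if p.1.1 = p.1.2 then b else a) * ‖F p.1.1 p.1.2‖ ^ α from rfl,
    sum_upperIndices n fun i j => (if i = j then b else a) * ‖F i j‖ ^ α, entryCost,
    Finset.sum_filter, Fintype.sum_prod_type, Finset.mul_sum, Finset.mul_sum,
    ← Finset.sum_add_distrib]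
  refine Finset.sum_congr rfl fun i _ => ?_
  have h : ∀ j : Fin n, (if i ≤ j then (if (i : ℕ) = j then b else a) * ‖F i j‖ ^ α else 0) =
      (if i = j then b * ‖F i j‖ ^ α else 0) + a * (if i < j then ‖F i j‖ ^ α else 0) := by
    intro j
    rcases lt_trichotomy i j with h | rfl | h
    · simp [h, h.le, h.ne, Fin.val_ne_of_ne h.ne]
    · simp
    · simp [not_le.2 h, not_lt.2 h.le, h.ne']
  simp only [h, Finset.sum_add_distrib, Finset.mul_sum, Matrix.of_apply]
  simp

/-- The stretched exponential smallness of one entry survives multiplication by the number of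
entries. -/
lemma tendsto_sq_mul_exp_neg {α : ℝ} (hα : 0 < α) (M : ℝ) {κ : ℝ} (hκ : 0 < κ) :
    Tendsto (fun N : ℕ => (N : ℝ) ^ 2 * (M * Real.exp (-(κ * (N : ℝ) ^ (α / 2))))) atTop (𝓝 0) := by
  have h := ((tendsto_rpow_mul_exp_neg_mul_atTop_nhds_zero (2 * (α / 2)⁻¹) κ hκ).comp
    (tendsto_natCast_rpow hα)).const_mul M
  rw [mul_zero] at h
  refine h.congr fun N => ?_
  simp only [Function.comp_apply]
  rw [← Real.rpow_mul (Nat.cast_nonneg N), mul_left_comm (α / 2), mul_inv_cancel₀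
    (half_pos hα).ne', mul_one, Real.rpow_two, neg_mul]
  ring

lemma entryCost_truncated {Ω : Type*} (X : ℕ → ℕ → Ω → ℂ) (α a b ε : ℝ) (N : ℕ) (ω : Ω) :
    entryCost α a b (truncated X ε N ω) =
      ∑ p ∈ upperIndices N, weight a b p * ‖truncEntry ε N (X p.1.1 p.1.2 ω)‖ ^ α :=
  entryCost_eq_sum α a b fun i j => truncEntry ε N (X i j ω)

/-! ### Exponential Chebyshev and almost sure admissibility of the truncated matrix -/

section Wigner

variable {Ω : Type*} [MeasurableSpace Ω] {P : Measure Ω} {X : ℕ → ℕ → Ω → ℂ} {α a b : ℝ} {ν₁ ν₂ : Measure UnitCircle}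

lemma IsWigner.identDistrib (hX : IsWigner P X) (p : UpperIndex) :
    IdentDistrib (X p.1.1 p.1.2) (if p.1.1 = p.1.2 then X 0 0 else X 0 1) P P := by
  split_ifs with h
  · rw [← h]
    exact hX.identDistrib_diag _
  · exact hX.identDistrib_offDiag _ _ (lt_of_le_of_ne p.2 h)

variable [IsProbabilityMeasure P]

/-- Weighting by `a` or `b` normalizes the critical exponent to `1`. Only two laws occur, so the
constants can be taken uniform in `p`. -/
lemma EntryAssumptions.truncEntry_bounds (hypo : EntryAssumptions P X α a b ν₁ ν₂)
    (hX : IsWigner P X) {ε : ℝ} (hε : 0 < ε) {θ : ℝ} (hθ0 : 0 < θ) (hθ : θ < 1) :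
    ∃ M : ℝ, 0 ≤ M ∧ ∃ κ : ℝ, 0 < κ ∧ ∀ (p : UpperIndex) (N : ℕ),
      ∫⁻ ω, ENNReal.ofReal (Real.exp (θ * (N : ℝ) ^ (α / 2) *
        (weight a b p * ‖truncEntry ε N (X p.1.1 p.1.2 ω)‖ ^ α))) ∂P ≤
        ENNReal.ofReal (1 + M * Real.exp (-(κ * (N : ℝ) ^ (α / 2)))) ∧
      P.real {ω | truncEntry ε N (X p.1.1 p.1.2 ω) ≠ 0} ≤
        M * Real.exp (-(κ * (N : ℝ) ^ (α / 2))) := by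
  obtain ⟨M₁, hM1, κ₁, hκ1, h1⟩ := hypo.tail_diag.truncEntry_bounds (hX.measurable 0 0)
    hypo.alpha_pos hypo.b_pos hε (mul_pos hθ0 hypo.b_pos)
    (mul_lt_of_lt_one_left hypo.b_pos hθ)
  obtain ⟨M₂, hM2, κ₂, hκ2, h2⟩ := hypo.tail_offDiag.truncEntry_bounds (hX.measurable 0 1)
    hypo.alpha_pos hypo.a_pos hε (mul_pos hθ0 hypo.a_pos)
    (mul_lt_of_lt_one_left hypo.a_pos hθ)
  have hmono : ∀ (N : ℕ) (M κ : ℝ), M ≤ max M₁ M₂ → min κ₁ κ₂ ≤ κ →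
      M * Real.exp (-(κ * (N : ℝ) ^ (α / 2))) ≤
        max M₁ M₂ * Real.exp (-(min κ₁ κ₂ * (N : ℝ) ^ (α / 2))) := by
    intro N M κ hM hκ
    refine mul_le_mul hM (Real.exp_le_exp.2 (neg_le_neg ?_)) (Real.exp_pos _).le
      (hM1.trans (le_max_left _ _))
    exact mul_le_mul_of_nonneg_right hκ (Real.rpow_nonneg (Nat.cast_nonneg N) _)
  refine ⟨max M₁ M₂, hM1.trans (le_max_left _ _), min κ₁ κ₂, lt_min hκ1 hκ2, fun p N => ?_⟩
  have hid := hX.identDistrib p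
  have hset : MeasurableSet {z : ℂ | truncEntry ε N z ≠ 0} :=
    measurable_truncEntry ε N (measurableSet_singleton 0).compl
  have hf : Measurable fun z : ℂ => ENNReal.ofReal (Real.exp (θ * (N : ℝ) ^ (α / 2) *
      (weight a b p * ‖truncEntry ε N z‖ ^ α))) := by
    have := measurable_truncEntry ε N
    fun_prop
  have e1 := (hid.comp hf).lintegral_eq
  have e2 := hid.measure_mem_eq hset
  simp only [Function.comp_def] at e1
  by_cases hp : p.1.1 = p.1.2
  · rw [if_pos hp] at e1 e2
    have hw : weight a b p = b := if_pos hp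
    constructor
    · rw [e1, hw]
      refine le_trans (le_of_eq ?_) ((h1 N).1.trans (ENNReal.ofReal_le_ofReal
        (add_le_add le_rfl (hmono N M₁ κ₁ (le_max_left _ _) (min_le_left _ _)))))
      congr 1 with ω
      congr 2
      ring
    · exact (congrArg ENNReal.toReal e2).trans_le
        ((h1 N).2.trans (hmono N M₁ κ₁ (le_max_left _ _) (min_le_left _ _)))
  · rw [if_neg hp] at e1 e2
    have hw : weight a b p = a := if_neg hp
    constructor
    · rw [e1, hw]
      refine le_trans (le_of_eq ?_) ((h2 N).1.trans (ENNReal.ofReal_le_ofReal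
        (add_le_add le_rfl (hmono N M₂ κ₂ (le_max_right _ _) (min_le_right _ _)))))
      congr 1 with ω
      congr 2
      ring
    · exact (congrArg ENNReal.toReal e2).trans_le
        ((h2 N).2.trans (hmono N M₂ κ₂ (le_max_right _ _) (min_le_right _ _)))

/-- Markov for `exp (θ v * cost)`. Its expectation is at most `(1 + x) ^ (N ^ 2) ≤ exp (N ^ 2 * x) ≤
exp 1`, the source of the `1` in the exponent. -/
lemma EntryAssumptions.eventually_measure_le_entryCost_le
    (hypo : EntryAssumptions P X α a b ν₁ ν₂) (hX : IsWigner P X) {ε : ℝ} (hε : 0 < ε) {θ : ℝ}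
    (hθ0 : 0 < θ) (hθ : θ < 1) (m : ℝ) :
    ∀ᶠ N : ℕ in atTop, P {ω | m ≤ entryCost α a b (truncated X ε N ω)} ≤
      ENNReal.ofReal (Real.exp (1 - θ * m * (N : ℝ) ^ (α / 2))) := by
  obtain ⟨M, hM, κ, hκ, hbd⟩ := hypo.truncEntry_bounds hX hε hθ0 hθ
  filter_upwards [(tendsto_sq_mul_exp_neg hypo.alpha_pos M hκ).eventually_lt_const one_pos]
    with N hN
  set v := (N : ℝ) ^ (α / 2) with hv
  have hv0 : 0 ≤ v := Real.rpow_nonneg (Nat.cast_nonneg N) _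
  set x := M * Real.exp (-(κ * v)) with hx
  have hx0 : 0 ≤ x := mul_nonneg hM (Real.exp_pos _).le
  let Y : UpperIndex → Ω → ℝ≥0∞ := fun p ω => ENNReal.ofReal (Real.exp (θ * v *
    (weight a b p * ‖truncEntry ε N (X p.1.1 p.1.2 ω)‖ ^ α)))
  have hg : ∀ p : UpperIndex, Measurable fun z : ℂ => ENNReal.ofReal (Real.exp (θ * v *
      (weight a b p * ‖truncEntry ε N z‖ ^ α))) := fun p => by
    have := measurable_truncEntry ε N
    fun_prop
  have hYm : ∀ p, Measurable (Y p) := fun p => (hg p).comp (hX.measurable _ _)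
  have hYi : iIndepFun Y P := hX.indep.comp _ hg
  have hYprod : ∀ ω, ∏ p ∈ upperIndices N, Y p ω =
      ENNReal.ofReal (Real.exp (θ * v * entryCost α a b (truncated X ε N ω))) := fun ω => by
    rw [entryCost_truncated, Finset.mul_sum, Real.exp_sum, ENNReal.ofReal_prod_of_nonneg]
    exact fun p _ => (Real.exp_pos _).le
  have hint : ∫⁻ ω, ∏ p ∈ upperIndices N, Y p ω ∂P ≤ ENNReal.ofReal (Real.exp 1) := by
    rw [lintegral_prod_eq_prod_lintegral_of_indepFun _ _ hYi hYm]
    calc ∏ p ∈ upperIndices N, ∫⁻ ω, Y p ω ∂P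
        ≤ ∏ p ∈ upperIndices N, ENNReal.ofReal (1 + x) :=
          Finset.prod_le_prod' fun p _ => (hbd p N).1
      _ = ENNReal.ofReal ((1 + x) ^ (upperIndices N).card) := by
          rw [Finset.prod_const, ENNReal.ofReal_pow (by positivity)]
      _ ≤ ENNReal.ofReal (Real.exp 1) := by
          refine ENNReal.ofReal_le_ofReal ?_
          calc (1 + x) ^ (upperIndices N).card ≤ (1 + x) ^ (N ^ 2) :=
                pow_le_pow_right₀ (by linarith) (card_upperIndices_le N)
            _ ≤ Real.exp x ^ (N ^ 2) := by
                refine pow_le_pow_left₀ (by linarith) ?_ _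
                linarith [Real.add_one_le_exp x]
            _ = Real.exp ((N : ℝ) ^ 2 * x) := by
                rw [← Real.exp_nat_mul]
                push_cast
                rfl
            _ ≤ Real.exp 1 := Real.exp_le_exp.2 hN.le
  have hmarkov := mul_meas_ge_le_lintegral (μ := P)
    (Finset.measurable_fun_prod (upperIndices N) fun p _ => hYm p)
    (ENNReal.ofReal (Real.exp (θ * v * m)))
  have hsub : {ω | m ≤ entryCost α a b (truncated X ε N ω)} ⊆
      {ω | ENNReal.ofReal (Real.exp (θ * v * m)) ≤ ∏ p ∈ upperIndices N, Y p ω} := fun ω hω => by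
    simp only [Set.mem_ofPred_eq] at hω ⊢
    rw [hYprod]
    refine ENNReal.ofReal_le_ofReal (Real.exp_le_exp.2 ?_)
    exact mul_le_mul_of_nonneg_left hω (by positivity)
  have hle : ENNReal.ofReal (Real.exp (θ * v * m)) *
      P {ω | m ≤ entryCost α a b (truncated X ε N ω)} ≤ ENNReal.ofReal (Real.exp 1) :=
    (mul_le_mul' le_rfl (measure_mono hsub)).trans (hmarkov.trans hint)
  rw [sub_eq_add_neg, Real.exp_add, ENNReal.ofReal_mul (Real.exp_pos _).le, Real.exp_neg,
    ENNReal.ofReal_inv_of_pos (Real.exp_pos _), ← div_eq_mul_inv,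
    ENNReal.le_div_iff_mul_le (Or.inl (by simp [Real.exp_pos])) (Or.inl ENNReal.ofReal_ne_top),
    mul_comm, show θ * m * v = θ * v * m by ring]
  exact hle

lemma EntryAssumptions.exists_regular [IsProbabilityMeasure ν₁] [IsProbabilityMeasure ν₂]
    (hypo : EntryAssumptions P X α a b ν₁ ν₂) (hX : IsWigner P X) :
    ∃ t : ℝ, 0 < t ∧ ∀ p : UpperIndex, ∀ᵐ ω ∂P,
      X p.1.1 p.1.2 ω ∈ regularSet (if p.1.1 = p.1.2 then ν₁ else ν₂) t := by
  have him : ∀ ω, (X 0 0 ω).im = 0 := fun ω =>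
    Complex.conj_eq_iff_im.1 (hX.hermitian 0 0 ω).symm
  obtain ⟨t₁, ht1, h1⟩ := hypo.angle_diag.ae_mem_regularSet_of_im_eq_zero him
  obtain ⟨t₂, ht2, h2⟩ := hypo.angle_offDiag.ae_mem_regularSet_of_indep hypo.tail_offDiag
    hypo.alpha_pos hypo.alpha_lt_two hypo.a_pos hypo.indep_re_im
  refine ⟨max t₁ t₂, lt_max_of_lt_left ht1, fun p => ?_⟩
  have hid := hX.identDistrib p
  by_cases hp : p.1.1 = p.1.2
  · rw [if_pos hp] at hid ⊢
    exact hid.symm.ae_mem_snd (measurableSet_regularSet _ _)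
      (h1.mono fun ω hω => regularSet_mono _ (le_max_left _ _) hω)
  · rw [if_neg hp] at hid ⊢
    exact hid.symm.ae_mem_snd (measurableSet_regularSet _ _)
      (h2.mono fun ω hω => regularSet_mono _ (le_max_right _ _) hω)

/-- One threshold serves both laws, and there are countably many entries, hence a single null set.
-/
lemma EntryAssumptions.eventually_ae_mem_admissible [IsProbabilityMeasure ν₁]
    [IsProbabilityMeasure ν₂] (hypo : EntryAssumptions P X α a b ν₁ ν₂) (hX : IsWigner P X)
    {ε : ℝ} (hε : 0 < ε) :
    ∀ᶠ N : ℕ in atTop, ∀ᵐ ω ∂P, truncated X ε N ω ∈ admissible ε ν₁ ν₂ N := by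
  obtain ⟨t, ht, hreg⟩ := hypo.exists_regular hX
  filter_upwards [(tendsto_mul_sqrt_natCast hε).eventually_ge_atTop t] with N hN
  filter_upwards [ae_all_iff.2 hreg] with ω hω
  refine ⟨isHermitian_truncated hX ε N ω, fun i j hij => ?_⟩
  have := truncEntry_of_mem_regularSet hε ht hN (hω ⟨(i, j), hij⟩)
  simp only [Fin.val_inj] at this
  exact this

end Wigner

/-! ### Probability that the truncated matrix looks like a given finite matrix -/

open Classical in
/-- The infinite array obtained by completing a finite matrix by zeros. -/
noncomputable def zeroExtend {n : ℕ} (A : Matrix (Fin n) (Fin n) ℂ) (i j : ℕ) : ℂ :=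
  if h : i < n ∧ j < n then A ⟨i, h.1⟩ ⟨j, h.2⟩ else 0

lemma zeroExtend_apply {n : ℕ} (A : Matrix (Fin n) (Fin n) ℂ) (i j : Fin n) :
    zeroExtend A i j = A i j := by
  simp [zeroExtend]

lemma of_zeroExtend {n : ℕ} (A : Matrix (Fin n) (Fin n) ℂ) :
    (Matrix.of fun i j : Fin n => zeroExtend A i j) = A := by
  ext i j
  exact zeroExtend_apply A i j

lemma zeroExtend_eq_zero {n : ℕ} (A : Matrix (Fin n) (Fin n) ℂ) {i j : ℕ} (h : n ≤ j) :
    zeroExtend A i j = 0 := by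
  simp [zeroExtend, not_lt.2 h]

lemma entryCost_eq_sum_zeroExtend (α a b : ℝ) {n : ℕ} (A : Matrix (Fin n) (Fin n) ℂ) :
    entryCost α a b A = ∑ p ∈ upperIndices n, weight a b p * ‖zeroExtend A p.1.1 p.1.2‖ ^ α := by
  rw [← entryCost_eq_sum, of_zeroExtend]

lemma exists_delta_outlier_mem {n : ℕ} {A : Matrix (Fin n) (Fin n) ℂ} (hA : A.IsHermitian)
    {O : Set ℝ} (hO : IsOpen O) (hAO : outlier (topEigenvalue A) ∈ O) :
    ∃ δ : ℝ, 0 < δ ∧ ∀ B : Matrix (Fin n) (Fin n) ℂ, B.IsHermitian →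
      (∀ i j, ‖B i j - A i j‖ < δ) → outlier (topEigenvalue B) ∈ O := by
  obtain ⟨η, hη, hball⟩ := Metric.isOpen_iff.1 hO _ hAO
  have hcont : ContinuousOn (fun A : Fin n → Fin n → ℂ => outlier (topEigenvalue (Matrix.of A)))
      {A | (Matrix.of A).IsHermitian} := continuousOn_outlier_topEigenvalue n
  obtain ⟨δ, hδ, h⟩ := Metric.continuousOn_iff.1 hcont (fun i j => A i j) hA η hη
  refine ⟨δ, hδ, fun B hB hBA => hball (h (fun i j => B i j) hB ?_)⟩
  refine (dist_pi_lt_iff hδ).2 fun i => (dist_pi_lt_iff hδ).2 fun j => ?_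
  rw [dist_eq_norm]
  exact hBA i j

/-- Exact zeros outside the corner reduce the problem to the fixed size `n`, so that `δ` does not
depend on `N`. -/
lemma outlier_truncated_mem {Ω : Type*} [MeasurableSpace Ω] {P : Measure Ω} {X : ℕ → ℕ → Ω → ℂ}
    (hX : IsWigner P X) {ε δ : ℝ} {n N : ℕ} (hnN : n ≤ N) {A : Matrix (Fin n) (Fin n) ℂ}
    (hA : A.IsHermitian) {O : Set ℝ}
    (hO : ∀ B : Matrix (Fin n) (Fin n) ℂ, B.IsHermitian → (∀ i j, ‖B i j - A i j‖ < δ) →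
      outlier (topEigenvalue B) ∈ O) {ω : Ω}
    (hω : ∀ p ∈ upperIndices N,
      ‖truncEntry ε N (X p.1.1 p.1.2 ω) - zeroExtend A p.1.1 p.1.2‖ < δ ∧
        (zeroExtend A p.1.1 p.1.2 = 0 → truncEntry ε N (X p.1.1 p.1.2 ω) = 0)) :
    mu X ε N ω ∈ O := by
  have hC := isHermitian_truncated hX ε N ω
  have hinj : Function.Injective (Fin.castLE hnN) := Fin.castLE_injective hnN
  have hupper : ∀ i j : Fin N, i ≤ j → truncated X ε N ω i j ≠ 0 → (j : ℕ) < n := by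
    intro i j hij hne
    by_contra hlt
    exact hne ((hω ⟨(i, j), hij⟩ (mem_upperIndices.2 j.2)).2
      (zeroExtend_eq_zero A (not_lt.1 hlt)))
  have hsupp : ∀ i j, truncated X ε N ω i j ≠ 0 →
      i ∈ Set.range (Fin.castLE hnN) ∧ j ∈ Set.range (Fin.castLE hnN) := by
    intro i j hne
    have hlt : (i : ℕ) < n ∧ (j : ℕ) < n := by
      rcases le_total i j with hij | hij
      · have := hupper i j hij hne
        exact ⟨lt_of_le_of_lt hij this, this⟩
      · have := hupper j i hij (by
          rw [← hC.apply j i]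
          exact star_ne_zero.2 hne)
        exact ⟨this, lt_of_le_of_lt hij this⟩
    exact ⟨⟨⟨i, hlt.1⟩, rfl⟩, ⟨⟨j, hlt.2⟩, rfl⟩⟩
  rw [mu_eq_outlier, ← outlier_topEigenvalue_submatrix hC hinj hsupp]
  have hle : ∀ i j : Fin n, i ≤ j →
      ‖truncated X ε N ω (Fin.castLE hnN i) (Fin.castLE hnN j) - A i j‖ < δ := by
    intro i j hij
    have := (hω ⟨(i, j), hij⟩ (mem_upperIndices.2 (j.2.trans_le hnN))).1
    rwa [zeroExtend_apply] at this
  refine hO _ (hC.submatrix _) fun i j => ?_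
  rw [Matrix.submatrix_apply]
  rcases le_total i j with hij | hij
  · exact hle i j hij
  · rw [← hC.apply, ← hA.apply, ← star_sub, norm_star]
    exact hle j i hij

section Wigner

variable {Ω : Type*} [MeasurableSpace Ω] {P : Measure Ω} [IsProbabilityMeasure P]
  {X : ℕ → ℕ → Ω → ℂ} {α a b : ℝ} {ν₁ ν₂ : Measure UnitCircle}

lemma EntryAssumptions.eventually_truncEntry_near [IsProbabilityMeasure ν₁]
    [IsProbabilityMeasure ν₂] (hypo : EntryAssumptions P X α a b ν₁ ν₂) (hX : IsWigner P X)
    {ε : ℝ} (hε : 0 < ε) (hε1 : ε < 1) (p : UpperIndex) {w : ℂ} (hw1 : ε ≤ ‖w‖) (hw2 : ‖w‖ ≤ ε⁻¹)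
    (hw : w / (‖w‖ : ℂ) ∈ Subtype.val '' (if p.1.1 = p.1.2 then ν₁ else ν₂).support) {δ η : ℝ}
    (hδ : 0 < δ) (hη : 0 < η) :
    ∀ᶠ N : ℕ in atTop, Real.exp (-((weight a b p * ‖w‖ ^ α + η) * (N : ℝ) ^ (α / 2))) ≤
      P.real {ω | ‖truncEntry ε N (X p.1.1 p.1.2 ω) - w‖ < δ} := by
  obtain ⟨t, -, hreg⟩ := hypo.exists_regular hX
  have hid := hX.identDistrib p
  have hset : ∀ N, MeasurableSet {z : ℂ | ‖truncEntry ε N z - w‖ < δ} := fun N => by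
    have := measurable_truncEntry ε N
    exact measurableSet_lt (by fun_prop) measurable_const
  have hreal : ∀ N, P.real {ω | ‖truncEntry ε N (X p.1.1 p.1.2 ω) - w‖ < δ} =
      P.real {ω | ‖truncEntry ε N ((if p.1.1 = p.1.2 then X 0 0 else X 0 1) ω) - w‖ < δ} :=
    fun N => congrArg ENNReal.toReal (hid.measure_mem_eq (hset N))
  simp only [hreal]
  by_cases hp : p.1.1 = p.1.2
  · have hreg0 := hreg ⟨(0, 0), le_rfl⟩
    simp only [if_true] at hreg0
    simp only [weight, if_pos hp] at hw ⊢
    exact hypo.angle_diag.eventually_truncEntry_near hypo.tail_diag hypo.alpha_pos hypo.b_pos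
      hreg0 hε hε1 hw1 hw2 hw hδ hη
  · have hreg0 := hreg ⟨(0, 1), zero_le_one⟩
    simp only [zero_ne_one, if_false] at hreg0
    simp only [weight, if_neg hp] at hw ⊢
    exact hypo.angle_offDiag.eventually_truncEntry_near hypo.tail_offDiag hypo.alpha_pos
      hypo.a_pos hreg0 hε hε1 hw1 hw2 hw hδ hη

/-- By independence the probability splits into the corner, which costs about `entryCost α a b A`,
and the remaining entries, which all vanish with probability at least `1 / 2`. -/
lemma EntryAssumptions.eventually_le_measure_mu_mem [IsProbabilityMeasure ν₁]
    [IsProbabilityMeasure ν₂] (hypo : EntryAssumptions P X α a b ν₁ ν₂) (hX : IsWigner P X)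
    {ε : ℝ} (hε : 0 < ε) (hε1 : ε ≠ 1) {n : ℕ} {A : Matrix (Fin n) (Fin n) ℂ}
    (hA : A ∈ admissible ε ν₁ ν₂ n) {O : Set ℝ} (hO : IsOpen O)
    (hAO : outlier (topEigenvalue A) ∈ O) {η : ℝ} (hη : 0 < η) :
    ∀ᶠ N : ℕ in atTop,
      ENNReal.ofReal (Real.exp (-((entryCost α a b A + η) * (N : ℝ) ^ (α / 2)))) ≤
        P {ω | mu X ε N ω ∈ O} := by
  obtain ⟨δ, hδ, hδO⟩ := exists_delta_outlier_mem hA.1 hO hAO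
  obtain ⟨M, hM, κ, hκ, hbd⟩ := hypo.truncEntry_bounds hX hε (half_pos one_pos) one_half_lt_one
  set k : ℝ := ((upperIndices n).card : ℝ) with hk
  -- The slack `η` is divided into `k + 1` shares: one per corner entry and one for the factor `1 /
  -- 2`.
  have hη' : 0 < η / (k + 1) := by positivity
  have hhalf : ∀ᶠ N : ℕ in atTop,
      Real.exp (-(η / (k + 1) * (N : ℝ) ^ (α / 2))) ≤ 1 / 2 := by
    have h := (Real.tendsto_exp_neg_atTop_nhds_zero.comp
      ((tendsto_natCast_rpow hypo.alpha_pos).const_mul_atTop hη')).eventually_lt_const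
      (half_pos one_pos)
    exact h.mono fun N hN => le_of_lt hN
  have hsmall : ∀ᶠ N : ℕ in atTop,
      (N : ℝ) ^ 2 * (M * Real.exp (-(κ * (N : ℝ) ^ (α / 2)))) ≤ 1 / 2 :=
    ((tendsto_sq_mul_exp_neg hypo.alpha_pos M hκ).eventually_lt_const (half_pos one_pos)).mono
      fun N hN => le_of_lt hN
  let S : ℕ → UpperIndex → Set ℂ := fun N p =>
    {z | ‖truncEntry ε N z - zeroExtend A p.1.1 p.1.2‖ < δ ∧
      (zeroExtend A p.1.1 p.1.2 = 0 → truncEntry ε N z = 0)}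
  have hSm : ∀ N p, MeasurableSet (S N p) := fun N p => by
    have h := measurable_truncEntry ε N
    have h1 : MeasurableSet {z : ℂ | ‖truncEntry ε N z - zeroExtend A p.1.1 p.1.2‖ < δ} :=
      measurableSet_lt (by fun_prop) measurable_const
    have h2 : MeasurableSet {z : ℂ | truncEntry ε N z = 0} := h (measurableSet_singleton 0)
    exact h1.inter ((MeasurableSet.const _).imp h2)
  have hzero : ∀ (N : ℕ) (p : UpperIndex), zeroExtend A p.1.1 p.1.2 = 0 →
      1 - M * Real.exp (-(κ * (N : ℝ) ^ (α / 2))) ≤ P.real (X p.1.1 p.1.2 ⁻¹' S N p) := by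
    intro N p hp
    have heq : X p.1.1 p.1.2 ⁻¹' S N p = {ω | truncEntry ε N (X p.1.1 p.1.2 ω) ≠ 0}ᶜ := by
      ext ω
      simp only [S, hp, sub_zero, Set.mem_preimage, Set.mem_ofPred_eq, Set.mem_compl_iff, ne_eq,
        not_not, true_implies, and_iff_right_iff_imp]
      intro h
      rw [h, norm_zero]
      exact hδ
    have hm : MeasurableSet {ω | truncEntry ε N (X p.1.1 p.1.2 ω) ≠ 0} :=
      ((measurable_truncEntry ε N).comp (hX.measurable _ _)) (measurableSet_singleton 0).compl
    rw [heq, probReal_compl_eq_one_sub hm]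
    exact sub_le_sub_left (hbd p N).2 1
  have hblock : ∀ᶠ N : ℕ in atTop, ∀ p ∈ upperIndices n,
      Real.exp (-((weight a b p * ‖zeroExtend A p.1.1 p.1.2‖ ^ α + η / (k + 1)) *
        (N : ℝ) ^ (α / 2))) ≤ P.real (X p.1.1 p.1.2 ⁻¹' S N p) := by
    refine (Finset.eventually_all _).2 fun p hp => ?_
    by_cases h0 : zeroExtend A p.1.1 p.1.2 = 0
    · filter_upwards [hhalf, hsmall, eventually_ge_atTop 1] with N h1 h2 hN
      rw [h0, norm_zero, Real.zero_rpow hypo.alpha_pos.ne', mul_zero, zero_add]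
      refine h1.trans (le_trans ?_ (hzero N p h0))
      have hN' : (1 : ℝ) ≤ (N : ℝ) ^ 2 := one_le_pow₀ (Nat.one_le_cast.2 hN)
      have : 0 ≤ M * Real.exp (-(κ * (N : ℝ) ^ (α / 2))) := mul_nonneg hM (Real.exp_pos _).le
      nlinarith
    · have hj := mem_upperIndices.1 hp
      have hi := p.2.trans_lt hj
      have hval : zeroExtend A p.1.1 p.1.2 = A ⟨p.1.1, hi⟩ ⟨p.1.2, hj⟩ :=
        zeroExtend_apply A ⟨p.1.1, hi⟩ ⟨p.1.2, hj⟩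
      rcases hA.2 ⟨p.1.1, hi⟩ ⟨p.1.2, hj⟩ p.2 with h | ⟨h1, h2, h3⟩
      · exact absurd (hval.trans h) h0
      · rw [← hval] at h1 h2 h3
        simp only [Fin.mk.injEq] at h3
        -- A nonzero admissible entry forces `ε ≤ ε⁻¹`, excluding `ε > 1`. At `ε = 1` the shell
        -- would degenerate to a single modulus, whose probability is not controlled.
        have hlt : ε < 1 := by
          refine lt_of_le_of_ne ?_ hε1
          by_contra! hgt
          exact absurd (h1.trans h2) (not_le.2 ((inv_lt_one_of_one_lt₀ hgt).trans hgt))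
        filter_upwards [hypo.eventually_truncEntry_near hX hε hlt p h1 h2 h3 hδ hη'] with N hN
        refine hN.trans (measureReal_mono fun ω hω => ⟨hω, fun h => absurd h h0⟩)
  filter_upwards [hhalf, hsmall, hblock, eventually_ge_atTop n] with N h1 h2 h3 hN
  set v := (N : ℝ) ^ (α / 2) with hv
  set x := M * Real.exp (-(κ * v)) with hx
  have hx0 : 0 ≤ x := mul_nonneg hM (Real.exp_pos _).le
  have hsub : ⋂ p ∈ upperIndices N, X p.1.1 p.1.2 ⁻¹' S N p ⊆ {ω | mu X ε N ω ∈ O} := by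
    intro ω hω
    exact outlier_truncated_mem hX hN hA.1 hδO fun p hp => Set.mem_iInter₂.1 hω p hp
  refine le_trans ?_ (measure_mono hsub)
  rw [hX.indep.measure_inter_preimage_eq_mul (upperIndices N) (fun p _ => hSm N p),
    ENNReal.ofReal_le_iff_le_toReal (ENNReal.prod_ne_top fun p _ => measure_ne_top _ _),
    ENNReal.toReal_prod, ← Finset.prod_sdiff (upperIndices_mono hN)]
  have hrest : 1 / 2 ≤ ∏ p ∈ upperIndices N \ upperIndices n,
      (P (X p.1.1 p.1.2 ⁻¹' S N p)).toReal := by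
    have hcard : ((upperIndices N \ upperIndices n).card : ℝ) ≤ (N : ℝ) ^ 2 := by
      exact_mod_cast (Finset.card_le_card Finset.sdiff_subset).trans (card_upperIndices_le N)
    rcases (upperIndices N \ upperIndices n).eq_empty_or_nonempty with he | hne
    · rw [he, Finset.prod_empty]
      norm_num
    have hcard1 : (1 : ℝ) ≤ (upperIndices N \ upperIndices n).card := by
      exact_mod_cast hne.card_pos
    have hx1 : x ≤ 1 / 2 := by nlinarith
    -- Bernoulli's inequality, with at most `N ^ 2` factors and `N ^ 2 * x ≤ 1 / 2`.
    calc (1 : ℝ) / 2 ≤ 1 + (upperIndices N \ upperIndices n).card * -x := by nlinarith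
      _ ≤ (1 + -x) ^ (upperIndices N \ upperIndices n).card :=
          one_add_mul_le_pow (by linarith) _
      _ = ∏ p ∈ upperIndices N \ upperIndices n, (1 + -x) := by rw [Finset.prod_const]
      _ ≤ _ := by
          refine Finset.prod_le_prod (fun p _ => by linarith) fun p hp => ?_
          have hp' : n ≤ p.1.2 :=
            not_lt.1 fun h => (Finset.mem_sdiff.1 hp).2 (mem_upperIndices.2 h)
          exact (sub_eq_add_neg 1 x).symm.trans_le (hzero N p (zeroExtend_eq_zero A hp'))
  have hmain : Real.exp (-((entryCost α a b A + k * (η / (k + 1))) * v)) ≤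
      ∏ p ∈ upperIndices n, (P (X p.1.1 p.1.2 ⁻¹' S N p)).toReal := by
    calc Real.exp (-((entryCost α a b A + k * (η / (k + 1))) * v))
        = ∏ p ∈ upperIndices n, Real.exp (-((weight a b p * ‖zeroExtend A p.1.1 p.1.2‖ ^ α +
            η / (k + 1)) * v)) := by
          rw [← Real.exp_sum, Finset.sum_neg_distrib, ← Finset.sum_mul, Finset.sum_add_distrib,
            ← entryCost_eq_sum_zeroExtend, Finset.sum_const, nsmul_eq_mul]
      _ ≤ _ := Finset.prod_le_prod (fun p _ => (Real.exp_pos _).le) h3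
  have hsplit : -((entryCost α a b A + η) * v) =
      -(η / (k + 1) * v) + -((entryCost α a b A + k * (η / (k + 1))) * v) := by
    have : k + 1 ≠ 0 := by positivity
    field_simp
    ring
  rw [hsplit, Real.exp_add]
  exact mul_le_mul (h1.trans hrest) hmain (Real.exp_pos _).le
    (Finset.prod_nonneg fun p _ => ENNReal.toReal_nonneg)

end Wigner

/-! ### The rate function and its level sets -/

section Rate

variable {α a b ε : ℝ} {ν₁ ν₂ : Measure UnitCircle}

lemma matrixCost_eq {n : ℕ} {A : Matrix (Fin n) (Fin n) ℂ} (hA : A ∈ admissible ε ν₁ ν₂ n) :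
    matrixCost ε α a b ν₁ ν₂ A = ENNReal.ofReal (entryCost α a b A) :=
  if_pos hA

lemma mem_admissible_of_matrixCost_ne_top {n : ℕ} {A : Matrix (Fin n) (Fin n) ℂ}
    (h : matrixCost ε α a b ν₁ ν₂ A ≠ ∞) : A ∈ admissible ε ν₁ ν₂ n := by
  by_contra hA
  exact h (if_neg hA)

/-- The matrix competes in its own infimum. At `2` the rate vanishes, and size zero only produces
the value `2`. -/
lemma rate_outlier_le {n : ℕ} {A : Matrix (Fin n) (Fin n) ℂ} (hA : A ∈ admissible ε ν₁ ν₂ n) :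
    rate ε α a b ν₁ ν₂ (outlier (topEigenvalue A)) ≤ ENNReal.ofReal (entryCost α a b A) := by
  rcases (two_le_outlier (topEigenvalue A)).eq_or_lt with h | h
  · simp [rate, ← h]
  · have hn : 1 ≤ n := by
      by_contra! hn
      obtain rfl : n = 0 := by omega
      rw [Subsingleton.elim A 0, outlier_topEigenvalue_zero] at h
      exact lt_irrefl _ h
    rw [rate, if_pos h, ← matrixCost_eq hA]
    exact iInf_le_of_le n (iInf_le_of_le hn (iInf_le_of_le A (iInf_le_of_le hA.1
      (iInf_le _ ((outlier_eq_iff h).1 rfl)))))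

/-- Treats `x = 2` like the other points: there the zero matrix is a competitor of cost zero. -/
lemma exists_of_rate_lt (hα : 0 < α) {x : ℝ} {c : ℝ≥0∞} (h : rate ε α a b ν₁ ν₂ x < c) :
    ∃ (n : ℕ) (A : Matrix (Fin n) (Fin n) ℂ), A ∈ admissible ε ν₁ ν₂ n ∧
      outlier (topEigenvalue A) = x ∧ ENNReal.ofReal (entryCost α a b A) < c := by
  unfold rate at h
  split_ifs at h with h1 h2
  · simp only [iInf_lt_iff] at h
    obtain ⟨n, -, A, -, hA, hlt⟩ := h
    have hadm := mem_admissible_of_matrixCost_ne_top (hlt.trans_le le_top).ne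
    exact ⟨n, A, hadm, (outlier_eq_iff h1).2 hA, matrixCost_eq hadm ▸ hlt⟩
  · refine ⟨1, 0, ⟨Matrix.isHermitian_zero, fun i j _ => Or.inl rfl⟩, ?_, ?_⟩
    · rw [outlier_topEigenvalue_zero, h2]
    · simpa [entryCost, Real.zero_rpow hα.ne'] using h
  · exact absurd h (not_lt.2 le_top)

lemma entryCost_submatrix_le (ha : 0 ≤ a) (hb : 0 ≤ b) {m n : ℕ} (A : Matrix (Fin n) (Fin n) ℂ)
    (f : Fin m ↪o Fin n) : entryCost α a b (A.submatrix f f) ≤ entryCost α a b A := by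
  unfold entryCost
  refine add_le_add (mul_le_mul_of_nonneg_left ?_ hb) (mul_le_mul_of_nonneg_left ?_ ha)
  · exact sum_comp_le_of_injective f.injective (g := fun i => ‖A i i‖ ^ α) fun i => by positivity
  · rw [Finset.sum_filter, Finset.sum_filter]
    refine le_trans (le_of_eq ?_) (sum_comp_le_of_injective (f.injective.prodMap f.injective)
      (g := fun p => if p.1 < p.2 then ‖A p.1 p.2‖ ^ α else 0) fun p => by positivity)
    refine Finset.sum_congr rfl fun p _ => ?_
    simp

lemma submatrix_mem_admissible {m n : ℕ} {A : Matrix (Fin n) (Fin n) ℂ}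
    (hA : A ∈ admissible ε ν₁ ν₂ n) (f : Fin m ↪o Fin n) :
    A.submatrix f f ∈ admissible ε ν₁ ν₂ m := by
  refine ⟨hA.1.submatrix f, fun i j hij => ?_⟩
  have := hA.2 (f i) (f j) (f.monotone hij)
  simpa only [Matrix.submatrix_apply, f.injective.eq_iff] using this

lemma norm_bounds_of_mem_admissible {n : ℕ} {A : Matrix (Fin n) (Fin n) ℂ}
    (hA : A ∈ admissible ε ν₁ ν₂ n) (i j : Fin n) :
    A i j = 0 ∨ (ε ≤ ‖A i j‖ ∧ ‖A i j‖ ≤ ε⁻¹) := by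
  have key : ∀ i j : Fin n, i ≤ j → A i j = 0 ∨ (ε ≤ ‖A i j‖ ∧ ‖A i j‖ ≤ ε⁻¹) :=
    fun i j hij => (hA.2 i j hij).imp id fun h => ⟨h.1, h.2.1⟩
  rcases le_total i j with hij | hij
  · exact key i j hij
  · rw [← hA.1.apply, norm_star, star_eq_zero]
    exact key j i hij

/-- Each nonzero entry on or above the diagonal costs at least `min a b * ε ^ α` and accounts for at
most two nonzero rows, hence the factor `2`. -/
lemma card_nonzero_rows_le (hα : 0 < α) (ha : 0 < a) (hb : 0 < b) (hε : 0 < ε) {n : ℕ}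
    {A : Matrix (Fin n) (Fin n) ℂ} (hA : A ∈ admissible ε ν₁ ν₂ n) {S : Finset (Fin n)}
    (hS : ∀ i ∈ S, ∃ j, A i j ≠ 0) :
    (S.card : ℝ) * (min a b * ε ^ α) ≤ 2 * entryCost α a b A := by
  classical
  set T := (upperIndices n).filter fun p => zeroExtend A p.1.1 p.1.2 ≠ 0 with hT
  have hw : ∀ p : UpperIndex, min a b ≤ weight a b p := fun p => by
    unfold weight
    split_ifs
    exacts [min_le_right _ _, min_le_left _ _]
  have hmin : 0 < min a b := lt_min ha hb
  have h1 : (T.card : ℝ) * (min a b * ε ^ α) ≤ entryCost α a b A := by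
    rw [entryCost_eq_sum_zeroExtend, ← nsmul_eq_mul]
    refine (Finset.card_nsmul_le_sum T
      (fun p => weight a b p * ‖zeroExtend A p.1.1 p.1.2‖ ^ α) _ fun p hp => ?_).trans
      (Finset.sum_le_sum_of_subset_of_nonneg (Finset.filter_subset _ _) fun p _ _ =>
        mul_nonneg (hmin.le.trans (hw p)) (by positivity))
    obtain ⟨hp1, hp2⟩ := Finset.mem_filter.1 hp
    have hj := mem_upperIndices.1 hp1
    have hval : zeroExtend A p.1.1 p.1.2 = A ⟨p.1.1, p.2.trans_lt hj⟩ ⟨p.1.2, hj⟩ :=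
      zeroExtend_apply A ⟨p.1.1, p.2.trans_lt hj⟩ ⟨p.1.2, hj⟩
    rw [hval] at hp2 ⊢
    rcases norm_bounds_of_mem_admissible hA ⟨p.1.1, p.2.trans_lt hj⟩ ⟨p.1.2, hj⟩ with h | h
    · exact absurd h hp2
    · exact mul_le_mul (hw p) (Real.rpow_le_rpow hε.le h.1 hα.le) (by positivity)
        (hmin.le.trans (hw p))
  have h2 : S.map Fin.valEmbedding ⊆ T.image (fun p => p.1.1) ∪ T.image (fun p => p.1.2) := by
    intro k hk
    obtain ⟨i, hi, rfl⟩ := Finset.mem_map.1 hk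
    obtain ⟨j, hj⟩ := hS i hi
    rcases le_total i j with hij | hij
    · refine Finset.mem_union_left _ (Finset.mem_image.2 ⟨⟨(i, j), hij⟩, ?_, rfl⟩)
      refine Finset.mem_filter.2 ⟨mem_upperIndices.2 j.2, ?_⟩
      rwa [zeroExtend_apply]
    · refine Finset.mem_union_right _ (Finset.mem_image.2 ⟨⟨(j, i), hij⟩, ?_, rfl⟩)
      refine Finset.mem_filter.2 ⟨mem_upperIndices.2 i.2, ?_⟩
      rw [zeroExtend_apply, ← hA.1.apply]
      exact star_ne_zero.2 hj
  have h3 : S.card ≤ 2 * T.card := by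
    rw [← Finset.card_map Fin.valEmbedding, two_mul]
    exact (Finset.card_le_card h2).trans ((Finset.card_union_le _ _).trans
      (add_le_add Finset.card_image_le Finset.card_image_le))
  have h3' : (S.card : ℝ) ≤ 2 * T.card := by exact_mod_cast h3
  have h4 : 0 ≤ min a b * ε ^ α := by positivity
  nlinarith [mul_le_mul_of_nonneg_right h3' h4]

/-- Deleting the zero rows and columns of an admissible matrix bounds its size by its cost. -/
lemma exists_compression (hα : 0 < α) (ha : 0 < a) (hb : 0 < b) (hε : 0 < ε) {n : ℕ}
    {A : Matrix (Fin n) (Fin n) ℂ} (hA : A ∈ admissible ε ν₁ ν₂ n) :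
    ∃ (m : ℕ) (B : Matrix (Fin m) (Fin m) ℂ), B ∈ admissible ε ν₁ ν₂ m ∧
      outlier (topEigenvalue B) = outlier (topEigenvalue A) ∧
      entryCost α a b B ≤ entryCost α a b A ∧
      (m : ℝ) * (min a b * ε ^ α) ≤ 2 * entryCost α a b A := by
  classical
  set S := Finset.univ.filter fun i => ∃ j, A i j ≠ 0 with hS
  have hmem : ∀ i, i ∈ S ↔ ∃ j, A i j ≠ 0 := fun i => by simp [hS]
  set f := S.orderEmbOfFin rfl with hf
  refine ⟨S.card, A.submatrix f f, submatrix_mem_admissible hA f,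
    outlier_topEigenvalue_submatrix hA.1 f.injective fun i j hij => ?_,
    entryCost_submatrix_le ha.le hb.le A f,
    card_nonzero_rows_le hα ha hb hε hA fun i hi => (hmem i).1 hi⟩
  rw [hf, Finset.range_orderEmbOfFin]
  refine ⟨(hmem i).2 ⟨j, hij⟩, (hmem j).2 ⟨i, ?_⟩⟩
  rw [← hA.1.apply]
  exact star_ne_zero.2 hij

lemma continuous_entryCost (hα : 0 < α) (n : ℕ) :
    Continuous fun A : Matrix (Fin n) (Fin n) ℂ => entryCost α a b A := by
  have h : ∀ i j, Continuous fun A : Matrix (Fin n) (Fin n) ℂ => ‖A i j‖ ^ α := fun i j =>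
    (continuous_id.matrix_elem i j).norm.rpow_const fun _ => Or.inr hα.le
  unfold entryCost
  exact (continuous_const.mul (continuous_finsetSum _ fun i _ => h i i)).add
    (continuous_const.mul (continuous_finsetSum _ fun p _ => h p.1 p.2))

lemma isClosed_admissible (hε : 0 < ε) (ν₁ ν₂ : Measure UnitCircle) (n : ℕ) :
    IsClosed (admissible ε ν₁ ν₂ n) := by
  have hentry : ∀ ν : Measure UnitCircle, IsClosed {z : ℂ | z = 0 ∨ (ε ≤ ‖z‖ ∧ ‖z‖ ≤ ε⁻¹ ∧
      z / (‖z‖ : ℂ) ∈ Subtype.val '' ν.support)} := by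
    intro ν
    have h1 : IsClosed {z : ℂ | ε ≤ ‖z‖} := isClosed_le continuous_const continuous_norm
    have h2 : IsClosed {z : ℂ | ‖z‖ ≤ ε⁻¹} := isClosed_le continuous_norm continuous_const
    -- The direction is discontinuous at `0`, but the gap between `0` and modulus `ε` keeps that
    -- point isolated.
    have hcont : ContinuousOn (fun z : ℂ => z / (‖z‖ : ℂ)) {z : ℂ | ε ≤ ‖z‖} := by
      refine continuousOn_id.div (by fun_prop) fun z hz => ?_
      exact_mod_cast (hε.trans_le hz).ne'
    have h3 := hcont.preimage_isClosed_of_isClosed h1 (isClosed_image_support ν)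
    have h4 := (isClosed_singleton (x := (0 : ℂ))).union (h3.inter h2)
    convert h4 using 1
    ext z
    simp only [Set.mem_ofPred_eq, Set.mem_union, Set.mem_singleton_iff, Set.mem_inter_iff,
      Set.mem_preimage]
    tauto
  have hH : IsClosed {A : Matrix (Fin n) (Fin n) ℂ | A.IsHermitian} :=
    isClosed_eq continuous_id.matrix_conjTranspose continuous_id
  have hE : IsClosed {A : Matrix (Fin n) (Fin n) ℂ | ∀ i j, i ≤ j → A i j = 0 ∨
      (ε ≤ ‖A i j‖ ∧ ‖A i j‖ ≤ ε⁻¹ ∧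
        A i j / (‖A i j‖ : ℂ) ∈ Subtype.val '' (if i = j then ν₁ else ν₂).support)} := by
    simp only [Set.ofPred_forall]
    exact isClosed_iInter fun i => isClosed_iInter fun j => isClosed_iInter fun _ =>
      (hentry _).preimage (continuous_id.matrix_elem i j)
  exact hH.inter hE

lemma isCompact_admissible (hε : 0 < ε) (ν₁ ν₂ : Measure UnitCircle) (n : ℕ) :
    IsCompact (admissible ε ν₁ ν₂ n) := by
  have hbox : IsCompact (Set.univ.pi fun _ : Fin n => Set.univ.pi fun _ : Fin n =>
      Metric.closedBall (0 : ℂ) ε⁻¹) :=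
    isCompact_univ_pi fun _ => isCompact_univ_pi fun _ => isCompact_closedBall _ _
  refine IsCompact.of_isClosed_subset (X := Matrix (Fin n) (Fin n) ℂ) hbox
    (isClosed_admissible hε ν₁ ν₂ n) fun A hA => ?_
  refine Set.mem_univ_pi.2 fun i => Set.mem_univ_pi.2 fun j => ?_
  rw [mem_closedBall_zero_iff]
  rcases norm_bounds_of_mem_admissible hA i j with h | h
  · rw [h, norm_zero]
    positivity
  · exact h.2

lemma isCompact_admissible_le (hα : 0 < α) (hε : 0 < ε) (t : ℝ) (n : ℕ) :
    IsCompact {A | A ∈ admissible ε ν₁ ν₂ n ∧ entryCost α a b A ≤ t} :=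
  (isCompact_admissible hε ν₁ ν₂ n).inter_right
    (isClosed_le (continuous_entryCost hα n) continuous_const)

/-- The cost attains its minimum on the compact fibre, so a strict lower bound has some room. -/
lemma eventually_forall_lt_entryCost (hα : 0 < α) (hε : 0 < ε) {x t : ℝ} {n : ℕ}
    (h : ∀ A ∈ admissible ε ν₁ ν₂ n, outlier (topEigenvalue A) = x → t < entryCost α a b A) :
    ∀ᶠ s in 𝓝[>] t, ∀ A ∈ admissible ε ν₁ ν₂ n, outlier (topEigenvalue A) = x →
      s < entryCost α a b A := by
  have hcompact : IsCompact
      (admissible ε ν₁ ν₂ n ∩ (fun A => outlier (topEigenvalue A)) ⁻¹' {x}) := by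
    refine (isCompact_admissible hε ν₁ ν₂ n).of_isClosed_subset ?_ Set.inter_subset_left
    exact ((continuousOn_outlier_topEigenvalue n).mono fun A hA =>
      hA.1).preimage_isClosed_of_isClosed (isClosed_admissible hε ν₁ ν₂ n) isClosed_singleton
  rcases Set.eq_empty_or_nonempty
    (admissible ε ν₁ ν₂ n ∩ (fun A => outlier (topEigenvalue A)) ⁻¹' {x}) with he | hne
  · refine Eventually.of_forall fun s A hA hx => ?_
    have : A ∈ admissible ε ν₁ ν₂ n ∩ (fun A => outlier (topEigenvalue A)) ⁻¹' {x} := ⟨hA, hx⟩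
    rw [he] at this
    exact absurd this (Set.notMem_empty A)
  · obtain ⟨A₀, ⟨hA0, hx0⟩, hmin⟩ :=
      hcompact.exists_isMinOn hne (continuous_entryCost (a := a) (b := b) hα n).continuousOn
    filter_upwards [Ioo_mem_nhdsGT (h A₀ hA0 hx0)] with s hs A hA hx
    exact hs.2.trans_le (hmin ⟨hA, hx⟩)

/-- The infimum is attained: compression brings near-minimizers into finitely many sizes, and in
each size the minimum exists. The `t + 1` leaves room for costs slightly above `t`. -/
lemma exists_of_rate_le (hα : 0 < α) (ha : 0 < a) (hb : 0 < b) (hε : 0 < ε) {x : ℝ} {t : ℝ≥0}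
    (h : rate ε α a b ν₁ ν₂ x ≤ t) :
    ∃ (n : ℕ) (A : Matrix (Fin n) (Fin n) ℂ), A ∈ admissible ε ν₁ ν₂ n ∧
      outlier (topEigenvalue A) = x ∧ entryCost α a b A ≤ t ∧
      (n : ℝ) * (min a b * ε ^ α) ≤ 2 * (t + 1) := by
  by_contra! hcon
  have hpos : 0 < min a b * ε ^ α := mul_pos (lt_min ha hb) (Real.rpow_pos_of_pos hε α)
  have hev : ∀ᶠ s in 𝓝[>] (t : ℝ), ∀ n ∈ Finset.range (⌊2 * ((t : ℝ) + 1) /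
      (min a b * ε ^ α)⌋₊ + 1), ∀ A ∈ admissible ε ν₁ ν₂ n, outlier (topEigenvalue A) = x →
        s < entryCost α a b A := by
    refine (Finset.eventually_all _).2 fun n hn => ?_
    refine eventually_forall_lt_entryCost hα hε fun A hA hx => ?_
    by_contra! hle
    refine absurd (hcon n A hA hx hle) (not_lt.2 ?_)
    have hn' := Nat.lt_succ_iff.1 (Finset.mem_range.1 hn)
    rw [Nat.le_floor_iff (by positivity), le_div_iff₀ hpos] at hn'
    exact hn'
  obtain ⟨s, hs, hts, hs1⟩ := (hev.and (Ioo_mem_nhdsGT (lt_add_one (t : ℝ)))).exists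
  have hlt : rate ε α a b ν₁ ν₂ x < ENNReal.ofReal s := by
    refine h.trans_lt ?_
    rwa [← ENNReal.ofReal_coe_nnreal, ENNReal.ofReal_lt_ofReal_iff (t.2.trans_lt hts)]
  obtain ⟨n, A, hA, hx, hcost⟩ := exists_of_rate_lt hα hlt
  obtain ⟨m, B, hB, hBx, hBA, hm⟩ := exists_compression hα ha hb hε hA
  rw [ENNReal.ofReal_lt_ofReal_iff (t.2.trans_lt hts)] at hcost
  refine absurd (hs m ?_ B hB (hBx.trans hx)) (not_lt.2 (hBA.trans hcost.le))
  rw [Finset.mem_range, Nat.lt_succ_iff, Nat.le_floor_iff (by positivity), le_div_iff₀ hpos]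
  linarith

lemma isCompact_rate_le (hα : 0 < α) (ha : 0 < a) (hb : 0 < b) (hε : 0 < ε) (t : ℝ≥0) :
    IsCompact {x | rate ε α a b ν₁ ν₂ x ≤ t} := by
  have hpos : 0 < min a b * ε ^ α := mul_pos (lt_min ha hb) (Real.rpow_pos_of_pos hε α)
  have heq : {x | rate ε α a b ν₁ ν₂ x ≤ t} =
      ⋃ n ∈ Finset.range (⌊2 * ((t : ℝ) + 1) / (min a b * ε ^ α)⌋₊ + 1),
        (fun A : Matrix (Fin n) (Fin n) ℂ => outlier (topEigenvalue A)) ''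
          {A | A ∈ admissible ε ν₁ ν₂ n ∧ entryCost α a b A ≤ t} := by
    ext x
    simp only [Set.mem_iUnion]
    constructor
    · intro hx
      obtain ⟨n, A, hA, hAx, hcost, hn⟩ := exists_of_rate_le hα ha hb hε hx
      refine ⟨n, ?_, A, ⟨hA, hcost⟩, hAx⟩
      rw [Finset.mem_range, Nat.lt_succ_iff, Nat.le_floor_iff (by positivity), le_div_iff₀ hpos]
      exact hn
    · rintro ⟨n, -, A, ⟨hA, hcost⟩, rfl⟩
      refine (rate_outlier_le hA).trans ?_
      rw [← ENNReal.ofReal_coe_nnreal]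
      exact ENNReal.ofReal_le_ofReal hcost
  rw [heq]
  refine (Finset.range _).isCompact_biUnion fun n _ => ?_
  exact (isCompact_admissible_le hα hε t n).image_of_continuousOn
    ((continuousOn_outlier_topEigenvalue n).mono fun A hA => hA.1.1)

lemma lowerSemicontinuous_of_isCompact_le {𝒳 : Type*} [TopologicalSpace 𝒳] [T2Space 𝒳]
    {J : 𝒳 → ℝ≥0∞} (h : ∀ t : ℝ≥0, IsCompact {x | J x ≤ t}) : LowerSemicontinuous J := by
  rw [lowerSemicontinuous_iff_isClosed_preimage]
  intro y
  induction y with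
  | top => simp
  | coe t => exact (h t).isClosed

end Rate

/-! ### Logarithmic limits -/

section ExponentialScale

variable {p : ℕ → ℝ≥0∞} {v : ℕ → ℝ}

lemma limsup_log_div_le (hv : Tendsto v atTop atTop) {K l : ℝ}
    (h : ∀ᶠ n in atTop, p n ≤ ENNReal.ofReal (Real.exp (K - l * v n))) :
    limsup (fun n => ENNReal.log (p n) / ((v n : ℝ) : EReal)) atTop ≤ ((-l : ℝ) : EReal) := by
  have hlim : Tendsto (fun n => ((K / v n - l : ℝ) : EReal)) atTop (𝓝 ((-l : ℝ) : EReal)) := by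
    have h0 := (hv.const_div_atTop K).sub_const l
    rw [zero_sub] at h0
    exact (continuous_coe_real_ereal.tendsto _).comp h0
  rw [← hlim.limsup_eq]
  refine limsup_le_limsup ?_
  filter_upwards [h, hv.eventually_gt_atTop 0] with n hn hpos
  have h1 : ENNReal.log (p n) ≤ ((K - l * v n : ℝ) : EReal) := by
    refine (ENNReal.log_le_log hn).trans_eq ?_
    rw [ENNReal.log_ofReal_of_pos (Real.exp_pos _), Real.log_exp]
  refine (EReal.div_le_div_right_of_nonneg (EReal.coe_nonneg.2 hpos.le) h1).trans_eq ?_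
  rw [← EReal.coe_div]
  congr 1
  field_simp

lemma le_liminf_log_div (hv : Tendsto v atTop atTop) {l : ℝ}
    (h : ∀ᶠ n in atTop, ENNReal.ofReal (Real.exp (-(l * v n))) ≤ p n) :
    ((-l : ℝ) : EReal) ≤ liminf (fun n => ENNReal.log (p n) / ((v n : ℝ) : EReal)) atTop := by
  refine le_liminf_of_le (by isBoundedDefault) ?_
  filter_upwards [h, hv.eventually_gt_atTop 0] with n hn hpos
  have h1 : ((-(l * v n) : ℝ) : EReal) ≤ ENNReal.log (p n) := by
    refine le_trans (le_of_eq ?_) (ENNReal.log_le_log hn)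
    rw [ENNReal.log_ofReal_of_pos (Real.exp_pos _), Real.log_exp]
  refine le_trans (le_of_eq ?_) (EReal.div_le_div_right_of_nonneg (EReal.coe_nonneg.2 hpos.le) h1)
  rw [← EReal.coe_div]
  congr 1
  field_simp

lemma limsup_log_div_nonpos (hv : ∀ n, 0 ≤ v n) (h : ∀ n, p n ≤ 1) :
    limsup (fun n => ENNReal.log (p n) / ((v n : ℝ) : EReal)) atTop ≤ 0 := by
  refine limsup_le_of_le (by isBoundedDefault) (Eventually.of_forall fun n => ?_)
  exact EReal.div_nonpos_of_nonpos_of_nonneg (ENNReal.log_le_zero_iff.2 (h n))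
    (EReal.coe_nonneg.2 (hv n))

end ExponentialScale

/-! ### The two large deviations bounds -/

section Wigner

variable {Ω : Type*} [MeasurableSpace Ω] {P : Measure Ω} [IsProbabilityMeasure P]
  {X : ℕ → ℕ → Ω → ℂ} {α a b : ℝ} {ν₁ ν₂ : Measure UnitCircle} [IsProbabilityMeasure ν₁]
  [IsProbabilityMeasure ν₂]

lemma EntryAssumptions.ldp_lower_bound (hypo : EntryAssumptions P X α a b ν₁ ν₂)
    (hX : IsWigner P X) {ε : ℝ} (hε : 0 < ε) (hε1 : ε ≠ 1) (B : Set ℝ) :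
    -((⨅ x ∈ interior B, rate ε α a b ν₁ ν₂ x : ℝ≥0∞) : EReal) ≤
      liminf (fun N : ℕ => ENNReal.log (P {ω | mu X ε N ω ∈ B}) /
        (((N : ℝ) ^ (α / 2) : ℝ) : EReal)) atTop := by
  by_contra! hlt
  rw [← EReal.neg_lt_neg_iff, neg_neg] at hlt
  obtain ⟨z, hz1, hz2⟩ := EReal.lt_iff_exists_real_btwn.1 hlt
  have hz0 : 0 < z := by
    exact_mod_cast (EReal.coe_ennreal_nonneg _).trans_lt hz1
  have hz3 : (⨅ x ∈ interior B, rate ε α a b ν₁ ν₂ x) < ENNReal.ofReal z := by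
    rw [← EReal.coe_ennreal_lt_coe_ennreal_iff, EReal.coe_ennreal_ofReal, max_eq_left hz0.le]
    exact hz1
  simp only [iInf_lt_iff] at hz3
  obtain ⟨x, hxB, hx⟩ := hz3
  obtain ⟨n, A, hA, rfl, hcost⟩ := exists_of_rate_lt hypo.alpha_pos hx
  rw [ENNReal.ofReal_lt_ofReal_iff hz0] at hcost
  have hev : ∀ᶠ N : ℕ in atTop, ENNReal.ofReal (Real.exp (-(z * (N : ℝ) ^ (α / 2)))) ≤
      P {ω | mu X ε N ω ∈ B} := by
    filter_upwards [hypo.eventually_le_measure_mu_mem hX hε hε1 hA isOpen_interior hxB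
      (sub_pos.2 hcost)] with N hN
    rw [add_sub_cancel] at hN
    exact hN.trans (measure_mono fun ω hω =>
      (interior_subset : interior B ⊆ B) hω)
  have := le_liminf_log_div (tendsto_natCast_rpow hypo.alpha_pos) hev
  rw [EReal.coe_neg, EReal.neg_le] at this
  exact absurd this (not_le.2 hz2)

lemma EntryAssumptions.ldp_upper_bound (hypo : EntryAssumptions P X α a b ν₁ ν₂)
    (hX : IsWigner P X) {ε : ℝ} (hε : 0 < ε) (B : Set ℝ) :
    limsup (fun N : ℕ => ENNReal.log (P {ω | mu X ε N ω ∈ B}) /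
        (((N : ℝ) ^ (α / 2) : ℝ) : EReal)) atTop ≤
      -((⨅ x ∈ closure B, rate ε α a b ν₁ ν₂ x : ℝ≥0∞) : EReal) := by
  by_contra! hlt
  rw [← EReal.neg_lt_neg_iff, neg_neg] at hlt
  obtain ⟨z, hz1, hz2⟩ := EReal.lt_iff_exists_real_btwn.1 hlt
  -- `ENNReal.ofReal` loses negative values; for `z ≤ 0` the trivial bound by probability one
  -- suffices.
  rcases le_or_gt z 0 with hz0 | hz0
  · have h0 := limsup_log_div_nonpos (v := fun N : ℕ => (N : ℝ) ^ (α / 2))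
      (fun N => by positivity) fun N => prob_le_one (μ := P) (s := {ω | mu X ε N ω ∈ B})
    rw [← EReal.neg_nonneg] at h0
    exact absurd (h0.trans_lt hz1) (not_lt.2 (EReal.coe_nonpos.2 hz0))
  have hz3 : ENNReal.ofReal z < ⨅ x ∈ closure B, rate ε α a b ν₁ ν₂ x := by
    rw [← EReal.coe_ennreal_lt_coe_ennreal_iff, EReal.coe_ennreal_ofReal, max_eq_left hz0.le]
    exact hz2
  have hsub : ∀ᶠ N : ℕ in atTop, P {ω | mu X ε N ω ∈ B} ≤
      P {ω | z ≤ entryCost α a b (truncated X ε N ω)} := by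
    filter_upwards [hypo.eventually_ae_mem_admissible hX hε] with N hN
    refine measure_mono_ae ?_
    filter_upwards [hN] with ω hω hB
    -- Almost surely `z < J (μ) ≤ cost`, since the truncated matrix is itself admissible.
    have h1 := hz3.trans_le (iInf₂_le (mu X ε N ω) (subset_closure hB))
    rw [mu_eq_outlier] at h1
    exact ((ENNReal.ofReal_lt_ofReal_iff_of_nonneg hz0.le).1
      (h1.trans_le (rate_outlier_le hω))).le
  have hθ : ∀ θ : ℝ, 0 < θ → θ < 1 → limsup (fun N : ℕ => ENNReal.log (P {ω | mu X ε N ω ∈ B}) /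
        (((N : ℝ) ^ (α / 2) : ℝ) : EReal)) atTop ≤ ((-(θ * z) : ℝ) : EReal) := by
    intro θ hθ0 hθ1
    refine limsup_log_div_le (tendsto_natCast_rpow hypo.alpha_pos) (K := 1) ?_
    filter_upwards [hsub, hypo.eventually_measure_le_entryCost_le hX hε hθ0 hθ1 z] with N h1 h2
    exact h1.trans h2
  -- Chebyshev loses the factor `θ < 1`, recovered by letting `θ` tend to `1` after `N`.
  have hlim : Tendsto (fun θ : ℝ => ((-(θ * z) : ℝ) : EReal)) (𝓝[<] 1) (𝓝 ((-z : ℝ) : EReal)) := by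
    refine (continuous_coe_real_ereal.tendsto _).comp ?_
    have : Tendsto (fun θ : ℝ => -(θ * z)) (𝓝 1) (𝓝 (-(1 * z))) :=
      (continuous_id.mul continuous_const).neg.tendsto 1
    rw [one_mul] at this
    exact this.mono_left nhdsWithin_le_nhds
  have hle := ge_of_tendsto hlim (by
    filter_upwards [Ioo_mem_nhdsLT one_pos] with θ hθ'
    exact hθ θ hθ'.1 hθ'.2)
  rw [EReal.coe_neg, EReal.le_neg] at hle
  exact absurd hle (not_le.2 hz1)

end Wigner

end WignerLDP

theorem mainTheorem9 {Ω : Type*} [MeasurableSpace Ω] (P : Measure Ω) [IsProbabilityMeasure P]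
    (X : ℕ → ℕ → Ω → ℂ) (hX : WignerLDP.IsWigner P X)
    (α a b : ℝ) (ν₁ ν₂ : Measure WignerLDP.UnitCircle)
    [IsProbabilityMeasure ν₁] [IsProbabilityMeasure ν₂]
    (hypo : WignerLDP.EntryAssumptions P X α a b ν₁ ν₂)
    (ε : ℝ) (hε : 0 < ε) (hε1 : ε ≠ 1) :
    WignerLDP.SatisfiesLDP P (fun N => WignerLDP.mu X ε N) (fun N => (N : ℝ) ^ (α / 2))
      (WignerLDP.rate ε α a b ν₁ ν₂) where
  measurable N := WignerLDP.measurable_mu hX ε N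
  speed_mono _ _ h := Real.rpow_le_rpow (Nat.cast_nonneg _) (Nat.cast_le.2 h)
    (half_pos hypo.alpha_pos).le
  speed_tendsto := WignerLDP.tendsto_natCast_rpow hypo.alpha_pos
  lowerSemicontinuous := WignerLDP.lowerSemicontinuous_of_isCompact_le
    (WignerLDP.isCompact_rate_le hypo.alpha_pos hypo.a_pos hypo.b_pos hε)
  good := WignerLDP.isCompact_rate_le hypo.alpha_pos hypo.a_pos hypo.b_pos hε
  lower_bound B _ := hypo.ldp_lower_bound hX hε hε1 B
  upper_bound B _ := hypo.ldp_upper_bound hX hε B
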